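/- Let $A$ be a finite alphabet. For finite strings, $s\preceq w$ means that $s$ is a suffix (ending string) of $w$. An irreducible tree is a finite set $\tau$ of nonempty strings such that no element of $\tau$ is a proper suffix of another one and no element can be replaced by a nonempty proper suffix without violating this property; $\ell(\tau)$ is the maximal length of its elements. Write $\tau\preceq\tau'$ if every $v\in\tau'$ has a suffix in $\tau$, and $\tau\prec\tau'$ if moreover $\tau\ne\tau'$. Let $(X_t)_{t\in\mathbb Z}$ be a stationary ergodic process on $A$ compatible with a probabilistic context tree $(\tau^*,p^*)$: $\tau^*$ is an irreducible tree, $p^*(\cdot|w)$ is a probability measure on $A$ for each $w\in\tau^*$, every $w\in\tau^*$ is a string of positive probability, every string $x_{-k}^{-1}$ of positive probability with $k\ge\ell(\tau^*)$ has a (unique) suffix $w\in\tau^*$ and $\mathbb P(X_0=a\mid X_{-k}^{-1}=x_{-k}^{-1})=p^*(a|w)$ for all $a\in A$; and for no nonempty proper suffix $u$ of an element of $\tau^*$ is the conditional law of $X_0$ the same given all pasts of positive probability and length at least $\ell(\tau^*)$ that end with $u$. Let $d(n)\to\infty$ be integers such that $d(n)\le\theta n$ for all large $n$, where $\theta<1$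 (for example $d(n)=o(n)$). For a string $v$ let $N_n(v)$ be the number of $t\in\{d(n)+1,\dots,n\}$ such that $v$ occurs in $X_1,\dots,X_n$ with its last symbol at time $t$; put $\hat p_n(a|w)=N_n(wa)/\sum_{b\in A}N_n(wb)$ and $L_\tau(X_1^n)=\prod_{w\in\tau}\prod_{a\in A}\hat p_n(a|w)^{N_n(wa)}$, where factors with exponent $0$ are $1$. Let $\mathcal T_n$ be the set of irreducible trees $\tau$ with $\ell(\tau)\le d(n)$ such that $\sum_bN_n(wb)>0$ for all $w\in\tau$ and every string $u$ with $\sum_bN_n(ub)>0$ has a suffix in $\tau$ or is a suffix of an element of $\tau$. The number of degrees of freedom is $\mathrm{df}(\tau)=(|A|-1)|\tau|$, or $\mathrm{df}(\tau)=\sum_{w\in\tau}\sum_{a\in A}\chi(wa)$ with a $\{0,1\}$-valued function $\chi$ such that $\chi(wa)=0$ implies $\chi(va)=0$ whenever $w\preceq v$. A champion tree is a $\tau\in\mathcal T_n$ that maximizes $L_\tau(X_1^n)$ among the trees in $\mathcal T_n$ with the same number of degrees of freedom, and whose likelihood is strictly larger than that of every tree in $\mathcal T_n$ with fewer degrees of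 freedom. Let $\mathcal C_n$ be the set of champion trees. Then there are deterministic constants $c(\tau^*,\tau)>0$ and $c(\tau,\tau')\ge0$, which depend only on the trees, the law of the process and $\theta$ (not on $n$, the sample, $d$ or $\mathrm{df}$), such that almost surely, for all sufficiently large $n$: (1) for every $\tau\in\mathcal C_n$ with $\tau\prec\tau^*$, $\ \log L_{\tau^*}(X_1^n)-\log L_\tau(X_1^n)\ge c(\tau^*,\tau)\,n$; (2) for all $\tau,\tau'\in\mathcal C_n$ with $\tau^*\preceq\tau\prec\tau'$, $\ \log L_{\tau'}(X_1^n)-\log L_\tau(X_1^n)\le c(\tau,\tau')\log n$. -/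

import Mathlib

open Filter MeasureTheory ProbabilityTheory

/-!
Finite strings over the alphabet `A` are lists written in chronological order (oldest symbol first),
so that `s <:+ w` says that `s` is a suffix (ending string) of `w`. Contexts are nonempty strings.
-/

namespace ContextTree

/-- No element of `τ` has a nonempty proper suffix in `τ`. -/
def SuffixProperty {A : Type*} (τ : Finset (List A)) : Prop :=
  ∀ w ∈ τ, ∀ u ∈ τ, u ≠ [] → u <:+ w → u = w

/-- Irreducible trees: finite sets of nonempty strings with the suffix property, in which no string
can be replaced by a (nonempty) proper suffix without violating the suffix property. -/
structure IsIrreducibleTree {A : Type*} [DecidableEq A] (τ : Finset (List A)) : Prop where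
  ne_nil : ∀ w ∈ τ, w ≠ []
  suffixProperty : SuffixProperty τ
  irreducible : ∀ w ∈ τ, ∀ u, u ≠ [] → u <:+ w → u ≠ w →
    ¬ SuffixProperty (insert u (τ.erase w))

/-- The height `ℓ(τ)`: the maximal length of a context. -/
def height {A : Type*} (τ : Finset (List A)) : ℕ := τ.sup List.length

/-- `τ ≼ τ'`: every element of `τ'` has a suffix in `τ`. -/
def TreeLE {A : Type*} (τ τ' : Finset (List A)) : Prop :=
  ∀ v ∈ τ', ∃ w ∈ τ, w <:+ v

/-- `τ ≺ τ'`. -/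
def TreeLT {A : Type*} (τ τ' : Finset (List A)) : Prop :=
  TreeLE τ τ' ∧ τ ≠ τ'

/-- A probabilistic context tree `(τ, p)`: an irreducible tree with a probability measure
`p(· | w)` on the alphabet for every context `w`. -/
structure ProbContextTree (A : Type*) [DecidableEq A] where
  tree : Finset (List A)
  irreducible : IsIrreducibleTree tree
  prob : {w : List A // w ∈ tree} → PMF A

/-! ### Processes with memory of variable length -/

/-- The event `{X_{-k}^{-1} = x}`, where `k` is the length of `x`. -/
def pastEvent {A Ω : Type*} (X : ℤ → Ω → A) (x : List A) : Set Ω :=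
  {ω | List.ofFn (fun i : Fin x.length => X ((i : ℤ) - (x.length : ℤ)) ω) = x}

/-- The event `{X_0 = a}`. -/
def presentEvent {A Ω : Type*} (X : ℤ → Ω → A) (a : A) : Set Ω := {ω | X 0 ω = a}

/-- `(X_t)` is a stationary ergodic process on `A`: the shift of `A^ℤ` preserves its law and is
ergodic for it. -/
structure IsStationaryErgodic {A Ω : Type*} [MeasurableSpace A] [MeasurableSpace Ω]
    (P : Measure Ω) (X : ℤ → Ω → A) : Prop where
  measurable : ∀ t, Measurable (X t)
  ergodic : Ergodic (fun (x : ℤ → A) (t : ℤ) => x (t + 1)) (P.map (fun ω t => X t ω))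

/-- The stationary ergodic process `(X_t)` has memory of variable length compatible with `(τ, p)`.
Conditional probabilities are only considered given pasts of positive probability. -/
structure IsCompatible {A Ω : Type*} [DecidableEq A] [MeasurableSpace A] [MeasurableSpace Ω]
    (P : Measure Ω) (X : ℤ → Ω → A) (T : ProbContextTree A) : Prop where
  stationaryErgodic : IsStationaryErgodic P X
  /-- contexts are strings that the process can produce -/
  context_pos : ∀ w ∈ T.tree, P (pastEvent X w) ≠ 0
  /-- given a past of length at least `ℓ(τ)`, the law of the next symbol is `p(· | w)`, with `w` the
  suffix of the past that belongs to `τ` (unique by the suffix property) -/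
  cond_eq : ∀ x : List A, height T.tree ≤ x.length → P (pastEvent X x) ≠ 0 →
    ∃ w : {w : List A // w ∈ T.tree}, w.1 <:+ x ∧
      ∀ a, P[presentEvent X a | pastEvent X x] = T.prob w a
  /-- no (nonempty) proper suffix of a context suffices to determine the law of the next symbol -/
  minimal : ∀ w ∈ T.tree, ∀ u, u ≠ [] → u <:+ w → u ≠ w →
    ¬ ∃ q : PMF A, ∀ x : List A, height T.tree ≤ x.length → u <:+ x →
      P (pastEvent X x) ≠ 0 → ∀ a, P[presentEvent X a | pastEvent X x] = q a

/-! ### Counts and likelihood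

A realization is a sequence `x : ℤ → A`, the sample is `x 1, …, x n`, and the number `d` stands
for the value at `n` of the height bound `d(n)`. -/

/-- The sample `x 1, …, x t` as a string. -/
def sample {A : Type*} (x : ℤ → A) (t : ℕ) : List A :=
  List.ofFn (fun i : Fin t => x ((i : ℤ) + 1))

/-- `N_n(v)`: the number of `t ∈ {d + 1, …, n}` such that the string `v` occurs in the sample
with its last symbol at time `t`. -/
def count {A : Type*} [DecidableEq A] (d n : ℕ) (x : ℤ → A) (v : List A) : ℕ :=
  ((Finset.Ioc d n).filter (fun t => v <:+ sample x t)).card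

/-- `∑_b N_n(w b)`. -/
def countCtx {A : Type*} [Fintype A] [DecidableEq A] (d n : ℕ) (x : ℤ → A) (w : List A) : ℕ :=
  ∑ b : A, count d n x (w ++ [b])

/-- The estimator `p̂_n(a | w) = N_n(w a) / ∑_b N_n(w b)`. -/
noncomputable def phat {A : Type*} [Fintype A] [DecidableEq A] (d n : ℕ) (x : ℤ → A)
    (w : List A) (a : A) : ℝ :=
  (count d n x (w ++ [a]) : ℝ) / (countCtx d n x w : ℝ)

/-- The likelihood `L_τ = ∏_{w ∈ τ} ∏_a p̂_n(a | w) ^ N_n(w a)`. A factor with exponent `0` is `1`,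
so that `L_τ` is always positive. -/
noncomputable def likelihood {A : Type*} [Fintype A] [DecidableEq A] (d n : ℕ) (x : ℤ → A)
    (τ : Finset (List A)) : ℝ :=
  ∏ w ∈ τ, ∏ a : A, phat d n x w a ^ count d n x (w ++ [a])

/-! ### Champion trees -/

/-- The set `𝒯_n` of candidate trees of the sample. -/
def candidates {A : Type*} [Fintype A] [DecidableEq A] (d n : ℕ) (x : ℤ → A) :
    Set (Finset (List A)) :=
  {τ | IsIrreducibleTree τ ∧ height τ ≤ d ∧
    (∀ w ∈ τ, 0 < countCtx d n x w) ∧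
    ∀ u : List A, 0 < countCtx d n x u → (∃ w ∈ τ, w <:+ u) ∨ ∃ w ∈ τ, u <:+ w}

/-- A consistent incidence function: a transition which is not allowed after a string is not allowed
after any longer string ending with it. -/
def IsConsistentIncidence {A : Type*} (χ : List A → A → Bool) : Prop :=
  ∀ (w v : List A) (a : A), w ≠ [] → w <:+ v → χ w a = false → χ v a = false

/-- The functions that count the degrees of freedom of a tree: either `(|A| - 1) |τ|` (no
restriction), or `∑_{w ∈ τ} ∑_a χ(w a)` for a consistent incidence function `χ`. -/
def IsDegreesOfFreedom {A : Type*} [Fintype A] (df : Finset (List A) → ℕ) : Prop :=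
  (∀ τ, df τ = (Fintype.card A - 1) * τ.card) ∨
  ∃ χ : List A → A → Bool, IsConsistentIncidence χ ∧
    ∀ τ, df τ = ∑ w ∈ τ, ∑ a : A, (χ w a).toNat

/-- `τ` maximizes the likelihood among the candidate trees with `g` degrees of freedom. -/
def IsMaximizer {A : Type*} [Fintype A] [DecidableEq A] (df : Finset (List A) → ℕ) (d n : ℕ)
    (x : ℤ → A) (g : ℕ) (τ : Finset (List A)) : Prop :=
  τ ∈ candidates d n x ∧ df τ = g ∧
    ∀ τ' ∈ candidates d n x, df τ' = g → likelihood d n x τ' ≤ likelihood d n x τ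

/-- The set `𝒞_n` of champion trees: the maximizers for some `g` degrees of freedom whose likelihood
is larger than that of the maximizers for all smaller numbers of degrees of freedom. (If the
maximizer for `g` is not unique, all of them are kept.) -/
def champions {A : Type*} [Fintype A] [DecidableEq A] (df : Finset (List A) → ℕ) (d n : ℕ)
    (x : ℤ → A) : Set (Finset (List A)) :=
  {τ | ∃ g, IsMaximizer df d n x g τ ∧
    ∀ g' < g, ∀ τ', IsMaximizer df d n x g' τ' → likelihood d n x τ' < likelihood d n x τ}

/-- The log-likelihood `log L_τ(X_1^n)` when the height bound is the function `d`. -/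
noncomputable def logLik {A : Type*} [Fintype A] [DecidableEq A] (d : ℕ → ℕ) (n : ℕ) (x : ℤ → A)
    (τ : Finset (List A)) : ℝ :=
  Real.log (likelihood (d n) n x τ)

end ContextTree

/-!
Only two facts about champion trees matter: they are candidate trees, and every candidate tree gives
a unique context to each past that is used in the counts, because all these pasts are at least as
long as the tree is high (`exists_suffix_sample_of_candidate`).

*Trees below `τ*`.* By the pointwise ergodic theorem (`ae_tendsto_birkhoffSum_div`, proved from the
recursion of the maximal Birkhoff sums), the frequency of every string in the window `(d n, n]`
tends to its probability; here `d n ≤ θ n` is used. Hence `log L_τ`, divided by the length of the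
window, tends to minus the conditional entropy of the present given the context in `τ` of the past
(`tendsto_logLik_div`). A tree `τ ≺ τ*` of observed strings consists of suffixes of contexts
(`exists_context_of_observed`), so there are only finitely many of them, and `τ` merges contexts
whose transition probabilities are not all equal, by minimality of `τ*`. Strict convexity of
`t ↦ t log t` makes the entropy strictly larger (`limitLogLik_lt`), and the difference of the
log-likelihoods grows at least linearly.

*Trees above `τ*`.* Let `π` be the conditional probability of the sample given its first `d n`
symbols. If `τ* ≼ τ`, then `L_τ ≥ π` by Gibbs' inequality (`prod_cond_le_likelihood`). For every
candidate `τ'`, `L_τ'` is the probability of the sample under transition probabilities that are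
given by a table of counts, and there are `(n + 1) ^ (|A| |τ'|)` such tables. For a fixed table the
likelihood ratio with respect to `π` is a supermartingale with mean at most `1`
(`lintegral_prod_ratio_le_one`), so `L_τ' / π` is at most a variable with mean at most
`(n + 1) ^ (|A| |τ'|)`. Since the set of trees is countable, the sum of these variables over all `n`
and `τ'`, with the weights `ε_τ' (n + 1) ^ (-|A| |τ'| - 2)` for a summable `ε`, has a finite mean.
It is therefore almost surely finite, which bounds `L_τ' / π` by a power of `n` simultaneously for
all trees (`ae_exists_ratioSum_le`); the weight `ε_τ'` enters the constant `c(τ, τ')`.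
-/

/-! ### The pointwise ergodic theorem -/

section Ergodic

variable {α : Type*} {S : α → α} {g : α → ℝ}

/-- The maximum of `0` and of the first `n` Birkhoff sums of `g` along the orbit of a point, defined
by the recursion it satisfies. -/
noncomputable def maxBirkhoff (S : α → α) (g : α → ℝ) : ℕ → α → ℝ
  | 0, _ => 0
  | n + 1, x => max 0 (g x + maxBirkhoff S g n (S x))

lemma maxBirkhoff_nonneg (n : ℕ) (x : α) : 0 ≤ maxBirkhoff S g n x := by
  cases n with
  | zero => exact le_rfl
  | succ n => exact le_max_left _ _

lemma maxBirkhoff_le_succ (n : ℕ) (x : α) : maxBirkhoff S g n x ≤ maxBirkhoff S g (n + 1) x := by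
  induction n generalizing x with
  | zero => exact le_max_left _ _
  | succ n ih =>
    simp only [maxBirkhoff]
    exact max_le_max le_rfl (by simpa [maxBirkhoff] using ih (S x))

lemma birkhoffSum_le_maxBirkhoff (n : ℕ) (x : α) : birkhoffSum S g n x ≤ maxBirkhoff S g n x := by
  induction n generalizing x with
  | zero => simp [maxBirkhoff]
  | succ n ih =>
    rw [birkhoffSum_succ']
    exact (add_le_add le_rfl (ih (S x))).trans (le_max_right _ _)

/-- The set where the maximal sums are bounded is invariant. -/
lemma bddAbove_maxBirkhoff_comp_iff (x : α) :
    BddAbove (Set.range fun n => maxBirkhoff S g n (S x)) ↔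
      BddAbove (Set.range fun n => maxBirkhoff S g n x) := by
  constructor
  · rintro ⟨C, hC⟩
    refine ⟨max 0 (g x + C), ?_⟩
    rintro _ ⟨n, rfl⟩
    refine (maxBirkhoff_le_succ n x).trans (max_le_max le_rfl ?_)
    exact add_le_add le_rfl (hC ⟨n, rfl⟩)
  · rintro ⟨C, hC⟩
    refine ⟨C - g x, ?_⟩
    rintro _ ⟨n, rfl⟩
    have h : maxBirkhoff S g (n + 1) x ≤ C := hC ⟨n + 1, rfl⟩
    have := (le_max_right 0 (g x + maxBirkhoff S g n (S x))).trans h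
    simp only
    linarith

variable [MeasurableSpace α] {μ : Measure α}

lemma measurable_maxBirkhoff (hS : Measurable S) (hg : Measurable g) (n : ℕ) :
    Measurable (maxBirkhoff S g n) := by
  induction n with
  | zero => exact measurable_const
  | succ n ih => exact measurable_const.max (hg.add (ih.comp hS))

lemma integrable_maxBirkhoff (hS : MeasurePreserving S μ μ) (hg : Integrable g μ) (n : ℕ) :
    Integrable (maxBirkhoff S g n) μ := by
  induction n with
  | zero => exact integrable_zero _ _ _
  | succ n ih =>
    exact (integrable_zero _ _ _).sup (hg.add (hS.integrable_comp_of_integrable ih))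

/-- If the maximal sums were unbounded, then `maxBirkhoff (n + 1) - maxBirkhoff n ∘ S` would tend to
`g` almost everywhere, while its integrals are nonnegative by monotonicity and invariance. -/
lemma ae_bddAbove_maxBirkhoff [IsProbabilityMeasure μ] (hS : Ergodic S μ) (hgm : Measurable g)
    (hg : Integrable g μ) (hneg : ∫ x, g x ∂μ < 0) :
    ∀ᵐ x ∂μ, BddAbove (Set.range fun n => maxBirkhoff S g n x) := by
  have hmeas : MeasurableSet {x | BddAbove (Set.range fun n => maxBirkhoff S g n x)} :=
    measurableSet_bddAbove_range fun n => measurable_maxBirkhoff hS.measurable hgm n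
  rcases hS.toPreErgodic.ae_mem_or_ae_notMem hmeas
    (by ext x; exact bddAbove_maxBirkhoff_comp_iff x) with h | h
  · exact h
  exfalso
  have hSp := hS.toMeasurePreserving
  let D : ℕ → α → ℝ := fun n x => maxBirkhoff S g (n + 1) x - maxBirkhoff S g n (S x)
  have hD : ∀ n x, D n x = max (-maxBirkhoff S g n (S x)) (g x) := by
    intro n x
    simp only [D, maxBirkhoff]
    rw [max_sub_sub_right (a := 0) (b := g x + maxBirkhoff S g n (S x))
      (c := maxBirkhoff S g n (S x)) |>.symm]
    congr 1 <;> ring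
  have hint : ∀ n, 0 ≤ ∫ x, D n x ∂μ := by
    intro n
    have h1 := integrable_maxBirkhoff hSp hg n
    have h2 := integrable_maxBirkhoff hSp hg (n + 1)
    have h3 : ∫ x, maxBirkhoff S g n (S x) ∂μ = ∫ x, maxBirkhoff S g n x ∂μ := by
      have := integral_map (μ := μ) hSp.measurable.aemeasurable (f := maxBirkhoff S g n)
        (measurable_maxBirkhoff hS.measurable hgm n).aestronglyMeasurable
      rw [hSp.map_eq] at this
      exact this.symm
    have h4 : ∫ x, D n x ∂μ
        = ∫ x, maxBirkhoff S g (n + 1) x ∂μ - ∫ x, maxBirkhoff S g n (S x) ∂μ :=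
      integral_sub h2 (hSp.integrable_comp_of_integrable h1)
    rw [h4, h3, sub_nonneg]
    exact integral_mono h1 h2 fun x => maxBirkhoff_le_succ n x
  have hlim : Tendsto (fun n => ∫ x, D n x ∂μ) atTop (nhds (∫ x, g x ∂μ)) := by
    refine tendsto_integral_of_dominated_convergence (fun x => |g x|) ?_ hg.abs ?_ ?_
    · intro n
      exact ((measurable_maxBirkhoff hS.measurable hgm (n + 1)).sub
        ((measurable_maxBirkhoff hS.measurable hgm n).comp hS.measurable)).aestronglyMeasurable
    · intro n
      refine ae_of_all _ fun x => ?_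
      rw [hD, Real.norm_eq_abs, abs_le]
      refine ⟨(neg_abs_le _).trans (le_max_right _ _), max_le ?_ (le_abs_self _)⟩
      linarith [maxBirkhoff_nonneg (S := S) (g := g) n (S x), abs_nonneg (g x)]
    · filter_upwards [h] with x hx
      have hx' : ¬ BddAbove (Set.range fun n => maxBirkhoff S g n (S x)) := by
        rw [bddAbove_maxBirkhoff_comp_iff]; exact hx
      have htop : Tendsto (fun n => maxBirkhoff S g n (S x)) atTop atTop :=
        tendsto_atTop_atTop_of_monotone (monotone_nat_of_le_succ fun n => maxBirkhoff_le_succ n _)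
          (fun b => by
            by_contra hb
            push Not at hb
            exact hx' ⟨b, by rintro _ ⟨n, rfl⟩; exact (hb n).le⟩)
      refine tendsto_const_nhds.congr' ?_
      filter_upwards [htop.eventually_ge_atTop (-g x)] with n hn
      rw [hD, max_eq_right (by linarith)]
  exact absurd (ge_of_tendsto' hlim hint) (not_le.mpr hneg)

lemma ae_eventually_birkhoffSum_le [IsProbabilityMeasure μ] (hS : Ergodic S μ) (hgm : Measurable g)
    (hg : Integrable g μ) {ε : ℝ} (hε : 0 < ε) :
    ∀ᵐ x ∂μ, ∀ᶠ n : ℕ in atTop, birkhoffSum S g n x ≤ (∫ y, g y ∂μ + ε) * n := by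
  set I := ∫ y, g y ∂μ with hI
  have hneg : ∫ x, (g x - (I + ε / 2)) ∂μ < 0 := by
    rw [integral_sub hg (integrable_const _)]
    simp only [integral_const, probReal_univ, smul_eq_mul, one_mul]
    linarith
  filter_upwards [ae_bddAbove_maxBirkhoff hS (hgm.sub_const _) (hg.sub (integrable_const _)) hneg]
    with x hx
  obtain ⟨C, hC⟩ := hx
  filter_upwards [(tendsto_natCast_atTop_atTop (R := ℝ)).eventually_ge_atTop (C / (ε / 2))]
    with n hn
  have h1 := (birkhoffSum_le_maxBirkhoff (S := S) (g := fun x => g x - (I + ε / 2)) n x).trans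
    (hC ⟨n, rfl⟩)
  have h2 : birkhoffSum S (fun x => g x - (I + ε / 2)) n x
      = birkhoffSum S g n x - n * (I + ε / 2) := by
    simp [birkhoffSum, Finset.sum_sub_distrib, mul_add]
  rw [div_le_iff₀ (by positivity)] at hn
  rw [h2] at h1
  linarith

/-- Birkhoff's pointwise ergodic theorem for an ergodic transformation. -/
theorem ae_tendsto_birkhoffSum_div [IsProbabilityMeasure μ] (hS : Ergodic S μ) (hgm : Measurable g)
    (hg : Integrable g μ) :
    ∀ᵐ x ∂μ, Tendsto (fun n : ℕ => birkhoffSum S g n x / n) atTop (nhds (∫ y, g y ∂μ)) := by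
  have h1 : ∀ᵐ x ∂μ, ∀ k : ℕ, ∀ᶠ n : ℕ in atTop,
      birkhoffSum S g n x ≤ (∫ y, g y ∂μ + 1 / ((k : ℝ) + 1)) * n :=
    ae_all_iff.2 fun k => ae_eventually_birkhoffSum_le hS hgm hg (by positivity)
  have h2 : ∀ᵐ x ∂μ, ∀ k : ℕ, ∀ᶠ n : ℕ in atTop,
      birkhoffSum S (fun x => -g x) n x ≤ (∫ y, -g y ∂μ + 1 / ((k : ℝ) + 1)) * n :=
    ae_all_iff.2 fun k => ae_eventually_birkhoffSum_le hS hgm.neg hg.neg (by positivity)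
  filter_upwards [h1, h2] with x hx1 hx2
  rw [Metric.tendsto_nhds]
  intro ε hε
  obtain ⟨k, hk⟩ := exists_nat_one_div_lt hε
  filter_upwards [hx1 k, hx2 k, eventually_gt_atTop 0] with n hn1 hn2 hn
  have hn' : (0 : ℝ) < n := by exact_mod_cast hn
  have h3 : birkhoffSum S (fun x => -g x) n x = -birkhoffSum S g n x := by
    simp [birkhoffSum]
  rw [h3, integral_neg] at hn2
  rw [Real.dist_eq, abs_lt, lt_sub_iff_add_lt, sub_lt_iff_lt_add, lt_div_iff₀ hn', div_lt_iff₀ hn']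
  have h4 : 1 / ((k : ℝ) + 1) * n < ε * n := mul_lt_mul_of_pos_right hk hn'
  constructor <;> nlinarith

end Ergodic

namespace ContextTree

/-! ### Occurrences of strings in a realization -/

section Strings

variable {A : Type*}

/-- The string `x (t - k + 1), …, x t`. -/
def segment (x : ℤ → A) (t : ℤ) (k : ℕ) : List A :=
  List.ofFn (fun i : Fin k => x (t + i + 1 - k))

@[simp] lemma length_segment (x : ℤ → A) (t : ℤ) (k : ℕ) : (segment x t k).length = k := by
  simp [segment]

@[simp] lemma length_sample (x : ℤ → A) (t : ℕ) : (sample x t).length = t := by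
  simp [sample]

lemma segment_shift (x : ℤ → A) (t s : ℤ) (k : ℕ) :
    segment (fun i => x (i + s)) t k = segment x (t + s) k := by
  unfold segment
  congr 1
  funext i
  ring_nf

lemma sample_eq_segment (x : ℤ → A) (t : ℕ) : sample x t = segment x t t := by
  unfold segment sample
  congr 1
  funext i
  congr 1
  ring

lemma iterate_shift (x : ℤ → A) (s : ℕ) :
    (fun (x : ℤ → A) (t : ℤ) => x (t + 1))^[s] x = fun t => x (t + s) := by
  induction s with
  | zero => simp
  | succ s ih =>
    rw [Function.iterate_succ_apply', ih]
    funext t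
    push_cast
    ring_nf

lemma pastEvent_eq {Ω : Type*} (X : ℤ → Ω → A) (v : List A) :
    pastEvent X v = {ω | segment (fun t => X t ω) (-1) v.length = v} := by
  unfold pastEvent segment
  ext ω
  simp only [Set.mem_ofPred_eq]
  have : (fun i : Fin v.length => X (-1 + i + 1 - v.length) ω)
      = fun i : Fin v.length => X (i - v.length) ω := by
    funext i
    congr 1
    ring
  rw [this]

lemma sample_succ (x : ℤ → A) (t : ℕ) : sample x (t + 1) = sample x t ++ [x (t + 1)] := by
  unfold sample
  rw [List.ofFn_succ_last]
  simp

lemma drop_sample (x : ℤ → A) {k t : ℕ} (h : k ≤ t) :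
    (sample x t).drop (t - k) = segment x t k := by
  apply List.ext_getElem
  · simp; omega
  · intro i h1 h2
    simp only [sample, segment, List.getElem_drop, List.getElem_ofFn]
    congr 1
    push_cast [Nat.cast_sub h]
    ring

lemma take_sample (x : ℤ → A) {k t : ℕ} (h : k ≤ t) : (sample x t).take k = sample x k := by
  apply List.ext_getElem
  · simpa using h
  · intro i h1 h2
    simp [sample, List.getElem_take, List.getElem_ofFn]

lemma suffix_sample_iff (x : ℤ → A) (t : ℕ) (v : List A) :
    v <:+ sample x t ↔ v.length ≤ t ∧ segment x t v.length = v := by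
  constructor
  · intro h
    have hl : v.length ≤ t := by simpa using h.length_le
    refine ⟨hl, ?_⟩
    rw [List.suffix_iff_eq_drop, length_sample, drop_sample x hl] at h
    exact h.symm
  · rintro ⟨hl, h⟩
    rw [List.suffix_iff_eq_drop, length_sample, drop_sample x hl, h]

lemma append_singleton_suffix_sample_succ (x : ℤ → A) (t : ℕ) (w : List A) (a : A) :
    w ++ [a] <:+ sample x (t + 1) ↔ w <:+ sample x t ∧ x (t + 1) = a := by
  rw [sample_succ]
  constructor
  · rintro ⟨u, hu⟩
    rw [← List.append_assoc] at hu
    obtain ⟨h1, h2⟩ := List.append_inj' hu rfl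
    exact ⟨⟨u, h1⟩, by simpa using h2.symm⟩
  · rintro ⟨⟨u, hu⟩, rfl⟩
    exact ⟨u, by rw [← hu]; simp⟩

variable [DecidableEq A]

lemma count_append_singleton (d n : ℕ) (x : ℤ → A) (w : List A) (a : A) :
    count d n x (w ++ [a])
      = ((Finset.Ico d n).filter fun s : ℕ => w <:+ sample x s ∧ x (s + 1) = a).card := by
  unfold count
  symm
  refine Finset.card_bij (fun s _ => s + 1) ?_ (fun _ _ _ _ h => Nat.succ_injective h) ?_
  · intro s hs
    simp only [Finset.mem_filter, Finset.mem_Ico, Finset.mem_Ioc] at hs ⊢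
    exact ⟨by omega, (append_singleton_suffix_sample_succ x s w a).2 hs.2⟩
  · intro t ht
    simp only [Finset.mem_filter, Finset.mem_Ioc] at ht
    obtain ⟨s, rfl⟩ : ∃ s, t = s + 1 := ⟨t - 1, by omega⟩
    refine ⟨s, ?_, rfl⟩
    simp only [Finset.mem_filter, Finset.mem_Ico]
    exact ⟨by omega, (append_singleton_suffix_sample_succ x s w a).1 ht.2⟩

lemma count_eq_sub {d n : ℕ} (h : d ≤ n) (x : ℤ → A) (v : List A) :
    (count d n x v : ℝ) = count 0 n x v - count 0 d x v := by
  have : count 0 n x v = count 0 d x v + count d n x v := by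
    unfold count
    rw [← Finset.card_union_of_disjoint, ← Finset.filter_union,
      Finset.Ioc_union_Ioc_eq_Ioc (Nat.zero_le d) h]
    refine Finset.disjoint_filter_filter ?_
    rw [Finset.disjoint_left]
    intro t h1 h2
    simp only [Finset.mem_Ioc] at h1 h2
    omega
  rw [this]
  push_cast
  ring

variable [Fintype A]

lemma countCtx_eq (d n : ℕ) (x : ℤ → A) (w : List A) :
    countCtx d n x w = ((Finset.Ico d n).filter fun s => w <:+ sample x s).card := by
  unfold countCtx
  simp_rw [count_append_singleton]
  rw [Finset.card_eq_sum_card_fiberwise (f := fun s : ℕ => x (s + 1)) (t := Finset.univ)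
    (fun _ _ => Finset.mem_coe.2 (Finset.mem_univ _))]
  refine Finset.sum_congr rfl fun a _ => ?_
  rw [Finset.filter_filter]

/-- A product over contexts and symbols, with the counts as exponents, is a product over times. -/
lemma prod_pow_count {M : Type*} [CommMonoid M] (d n : ℕ) (x : ℤ → A) (τ : Finset (List A))
    (f : List A → A → M) :
    ∏ w ∈ τ, ∏ a : A, f w a ^ count d n x (w ++ [a])
      = ∏ s ∈ Finset.Ico d n, ∏ w ∈ τ with w <:+ sample x s, f w (x (s + 1)) := by
  have h : ∀ w, ∏ a : A, f w a ^ count d n x (w ++ [a])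
      = ∏ s ∈ Finset.Ico d n with w <:+ sample x s, f w (x (s + 1)) := by
    intro w
    rw [← Finset.prod_fiberwise (g := fun s : ℕ => x (s + 1))]
    refine Finset.prod_congr rfl fun a _ => ?_
    rw [count_append_singleton, Finset.filter_filter, Finset.prod_congr rfl (g := fun _ => f w a),
      Finset.prod_const]
    intro s hs
    simp only [Finset.mem_filter] at hs
    rw [hs.2.2]
  simp_rw [h, Finset.prod_filter]
  exact Finset.prod_comm

end Strings

/-! ### Stationarity and frequencies -/

section Stationary

variable {A Ω : Type*} [MeasurableSpace A] [MeasurableSpace Ω] {P : Measure Ω} {X : ℤ → Ω → A}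

lemma measurable_path (hX : IsStationaryErgodic P X) : Measurable fun ω t => X t ω :=
  measurable_pi_lambda _ hX.measurable

lemma measurable_sample (hX : IsStationaryErgodic P X) (t : ℕ) :
    Measurable fun ω (i : Fin t) => X ((i : ℤ) + 1) ω :=
  measurable_pi_lambda _ fun _ => hX.measurable _

lemma measure_shift (hX : IsStationaryErgodic P X) {B : Set (ℤ → A)} (hB : MeasurableSet B)
    (s : ℕ) : P {ω | (fun t => X (t + s) ω) ∈ B} = P {ω | (fun t => X t ω) ∈ B} := by
  have hmp := hX.ergodic.toMeasurePreserving.iterate s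
  have h := hmp.measure_preimage hB.nullMeasurableSet
  rw [Measure.map_apply (measurable_path hX) hB,
    Measure.map_apply (measurable_path hX) (hmp.measurable hB)] at h
  convert h using 2 <;> (ext ω; simp [iterate_shift])

variable [Fintype A] [MeasurableSingletonClass A]

lemma measurableSet_segment (t : ℤ) (k : ℕ) (p : List A → Prop) :
    MeasurableSet {x : ℤ → A | p (segment x t k)} := by
  have h : Measurable fun (x : ℤ → A) (i : Fin k) => x (t + i + 1 - k) := by fun_prop
  exact h (Set.toFinite {z : Fin k → A | p (List.ofFn z)}).measurableSet

lemma measure_segment (hX : IsStationaryErgodic P X) (t : ℕ) (v : List A) :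
    P {ω | segment (fun i => X i ω) t v.length = v} = P (pastEvent X v) := by
  have h := measure_shift hX (measurableSet_segment (-1) v.length (fun y => y = v)) (t + 1)
  simp only [Set.mem_ofPred_eq] at h
  rw [pastEvent_eq, ← h]
  congr 2
  ext ω
  rw [segment_shift (fun i => X i ω) (-1) ((t + 1 : ℕ) : ℤ)]
  push_cast
  ring_nf

lemma measure_suffix_sample (hX : IsStationaryErgodic P X) {t : ℕ} {v : List A}
    (h : v.length ≤ t) :
    P {ω | v <:+ sample (fun i => X i ω) t} = P (pastEvent X v) := by
  rw [← measure_segment hX t v]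
  congr 1
  ext ω
  simp [suffix_sample_iff, h]

lemma measurableSet_pastEvent (hX : IsStationaryErgodic P X) (v : List A) :
    MeasurableSet (pastEvent X v) := by
  rw [pastEvent_eq]
  exact measurable_path hX (measurableSet_segment (-1) v.length fun y => y = v)

lemma measure_sample_and_next (hX : IsStationaryErgodic P X) (y : List A) (a : A) :
    P {ω | sample (fun i => X i ω) y.length = y ∧ X (y.length + 1) ω = a}
      = P (pastEvent X y ∩ presentEvent X a) := by
  have h0 : MeasurableSet {x : ℤ → A | x 0 = a} :=
    measurableSet_eq_fun (measurable_pi_apply 0) measurable_const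
  have hm : MeasurableSet {x : ℤ → A | segment x (-1) y.length = y ∧ x 0 = a} :=
    (measurableSet_segment (-1) y.length fun z => z = y).inter h0
  have h := measure_shift hX hm (y.length + 1)
  rw [pastEvent_eq]
  refine Eq.trans ?_ (h.trans (congrArg P (by ext ω; rfl)))
  congr 1
  ext ω
  simp only [Set.mem_ofPred_eq, sample_eq_segment]
  rw [segment_shift (fun i => X i ω) (-1) ((y.length + 1 : ℕ) : ℤ)]
  push_cast
  rw [show (-1 + ((y.length : ℤ) + 1)) = y.length by ring, zero_add]

lemma lintegral_sample (hX : IsStationaryErgodic P X) (t : ℕ) (g : List A → ENNReal) :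
    ∫⁻ ω, g (sample (fun i => X i ω) t) ∂P
      = ∑ z : Fin t → A, g (List.ofFn z) * P (pastEvent X (List.ofFn z)) := by
  have h := lintegral_map (μ := P) (f := fun z : Fin t → A => g (List.ofFn z))
    (measurable_of_finite _) (measurable_sample hX t)
  rw [lintegral_fintype] at h
  refine h.symm.trans (Finset.sum_congr rfl fun z _ => ?_)
  rw [Measure.map_apply (measurable_sample hX t) (measurableSet_singleton z),
    ← measure_suffix_sample hX (t := t) (v := List.ofFn z) (by simp)]
  congr 2
  ext ω
  simp only [Set.mem_preimage, Set.mem_singleton_iff, Set.mem_ofPred_eq]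
  constructor
  · rintro rfl; exact List.suffix_rfl
  · intro hs
    exact List.ofFn_injective (hs.eq_of_length (by simp)).symm

/-- Means of functions of the sample and the next symbol are sums over strings, weighted with the
probability of the string as a past and the conditional law of the present. -/
lemma lintegral_sample_next [IsProbabilityMeasure P] (hX : IsStationaryErgodic P X) (t : ℕ)
    (g : List A → A → ENNReal) :
    ∫⁻ ω, g (sample (fun i => X i ω) t) (X (t + 1) ω) ∂P
      = ∑ z : Fin t → A, ∑ a : A, g (List.ofFn z) a *
          (P[presentEvent X a | pastEvent X (List.ofFn z)] * P (pastEvent X (List.ofFn z))) := by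
  have hm : Measurable fun ω => ((fun i : Fin t => X ((i : ℤ) + 1) ω), X (t + 1) ω) :=
    (measurable_sample hX t).prodMk (hX.measurable _)
  have h := lintegral_map (μ := P) (f := fun z : (Fin t → A) × A => g (List.ofFn z.1) z.2)
    (measurable_of_finite _) hm
  rw [lintegral_fintype, Fintype.sum_prod_type] at h
  refine h.symm.trans (Finset.sum_congr rfl fun z _ => Finset.sum_congr rfl fun a _ => ?_)
  rw [Measure.map_apply hm (measurableSet_singleton _),
    cond_mul_eq_inter (measurableSet_pastEvent hX _),
    ← measure_sample_and_next hX]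
  congr 2
  ext ω
  simp only [Set.mem_preimage, Set.mem_singleton_iff, Set.mem_ofPred_eq, Prod.mk.injEq,
    List.length_ofFn]
  refine and_congr_left fun _ => ⟨?_, fun hs => List.ofFn_injective hs⟩
  rintro rfl
  rfl

/-- Almost surely, only strings of positive probability are observed. -/
lemma ae_measure_pastEvent_sample_ne_zero (hX : IsStationaryErgodic P X) :
    ∀ᵐ ω ∂P, ∀ t : ℕ, P (pastEvent X (sample (fun i => X i ω) t)) ≠ 0 := by
  classical
  refine ae_all_iff.2 fun t => ?_
  have h := lintegral_sample hX t fun y => if P (pastEvent X y) = 0 then 1 else 0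
  have h0 : ∑ z : Fin t → A, (if P (pastEvent X (List.ofFn z)) = 0 then (1 : ENNReal) else 0) *
      P (pastEvent X (List.ofFn z)) = 0 := by
    refine Finset.sum_eq_zero fun z _ => ?_
    split_ifs with hz <;> simp [hz]
  rw [h0] at h
  have hm : Measurable fun ω => (if P (pastEvent X (sample (fun i => X i ω) t)) = 0
      then (1 : ENNReal) else 0) :=
    (measurable_of_finite fun z : Fin t → A =>
      if P (pastEvent X (List.ofFn z)) = 0 then (1 : ENNReal) else 0).comp (measurable_sample hX t)
  filter_upwards [(lintegral_eq_zero_iff hm).1 h] with ω hω h1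
  simp [h1] at hω

variable [IsProbabilityMeasure P] [DecidableEq A]

/-- Almost surely, the relative frequency of every string tends to its probability. -/
lemma ae_tendsto_count_div (hX : IsStationaryErgodic P X) :
    ∀ᵐ ω ∂P, ∀ v : List A, Tendsto (fun n : ℕ => (count 0 n (fun i => X i ω) v : ℝ) / n) atTop
      (nhds (P.real (pastEvent X v))) := by
  refine ae_all_iff.2 fun v => ?_
  have : IsProbabilityMeasure (P.map fun ω t => X t ω) :=
    Measure.isProbabilityMeasure_map (measurable_path hX).aemeasurable
  set B : Set (ℤ → A) := {x | segment x 1 v.length = v} with hB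
  have hBm : MeasurableSet B := measurableSet_segment 1 v.length fun y => y = v
  have hlim := ae_of_ae_map (measurable_path hX).aemeasurable
    (ae_tendsto_birkhoffSum_div hX.ergodic (g := B.indicator 1)
      (measurable_one.indicator hBm) ((integrable_const (1 : ℝ)).indicator hBm))
  have hint : ∫ y, B.indicator (1 : (ℤ → A) → ℝ) y ∂(P.map fun ω t => X t ω)
      = P.real (pastEvent X v) := by
    rw [integral_indicator_one hBm, map_measureReal_apply (measurable_path hX) hBm]
    unfold Measure.real
    congr 1
    have := measure_segment hX 1 v
    rw [← this]
    rfl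
  rw [hint] at hlim
  filter_upwards [hlim] with ω hω
  set x : ℤ → A := fun t => X t ω with hx
  have hsum : ∀ n : ℕ, birkhoffSum (fun (x : ℤ → A) (t : ℤ) => x (t + 1)) (B.indicator 1) n x
      = (((Finset.Ioc 0 n).filter fun t : ℕ => segment x t v.length = v).card : ℝ) := by
    intro n
    rw [birkhoffSum, Finset.card_filter, Finset.range_eq_Ico]
    push_cast
    have hI : Finset.Ioc 0 n = (Finset.Ico 0 n).image (· + 1) := by
      ext t
      simp only [Finset.mem_Ioc, Finset.mem_image, Finset.mem_Ico]
      exact ⟨fun h => ⟨t - 1, by omega, by omega⟩, by rintro ⟨s, hs, rfl⟩; omega⟩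
    rw [hI, Finset.sum_image fun _ _ _ _ h => Nat.succ_injective h]
    refine Finset.sum_congr rfl fun s _ => ?_
    have hmem : (fun t => x (t + s)) ∈ B ↔ segment x ((s + 1 : ℕ) : ℤ) v.length = v := by
      rw [hB, Set.mem_ofPred_eq, segment_shift]
      push_cast
      rw [add_comm (1 : ℤ)]
    rw [iterate_shift]
    by_cases h : segment x ((s + 1 : ℕ) : ℤ) v.length = v
    · rw [Set.indicator_of_mem (hmem.2 h), if_pos h, Pi.one_apply]
    · rw [Set.indicator_of_notMem (mt hmem.1 h), if_neg h]
  -- occurrences that begin before time `1` are not counted: there are at most `|v|` of them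
  have hle : ∀ n : ℕ, (count 0 n x v : ℝ)
      ≤ (((Finset.Ioc 0 n).filter fun t : ℕ => segment x t v.length = v).card : ℝ) := by
    intro n
    refine Nat.cast_le.2 (Finset.card_le_card fun t ht => ?_)
    rw [Finset.mem_filter, suffix_sample_iff] at ht
    exact Finset.mem_filter.2 ⟨ht.1, ht.2.2⟩
  have hge : ∀ n : ℕ, (((Finset.Ioc 0 n).filter fun t : ℕ => segment x t v.length = v).card : ℝ)
      - v.length ≤ (count 0 n x v : ℝ) := by
    intro n
    rw [sub_le_iff_le_add]
    have : ((Finset.Ioc 0 n).filter fun t : ℕ => segment x t v.length = v)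
        ⊆ ((Finset.Ioc 0 n).filter fun t => v <:+ sample x t) ∪ Finset.range v.length := by
      intro t ht
      rw [Finset.mem_filter] at ht
      rw [Finset.mem_union, Finset.mem_filter, suffix_sample_iff, Finset.mem_range]
      by_cases h : v.length ≤ t
      · exact Or.inl ⟨ht.1, h, ht.2⟩
      · exact Or.inr (by omega)
    have := (Finset.card_le_card this).trans (Finset.card_union_le _ _)
    rw [Finset.card_range] at this
    exact_mod_cast this
  simp_rw [hsum] at hω
  have h0 : Tendsto (fun n : ℕ => (v.length : ℝ) / n) atTop (nhds 0) :=
    tendsto_const_div_atTop_nhds_zero_nat _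
  refine tendsto_of_tendsto_of_tendsto_of_le_of_le (by simpa using hω.sub h0) hω ?_ ?_
  · intro n
    simp only
    rw [← sub_div]
    exact div_le_div_of_nonneg_right (hge n) n.cast_nonneg
  · intro n
    exact div_le_div_of_nonneg_right (hle n) n.cast_nonneg

end Stationary

/-! ### Contexts of a compatible process -/

lemma IsIrreducibleTree.eq_of_suffix {A : Type*} [DecidableEq A] {τ : Finset (List A)}
    (hτ : IsIrreducibleTree τ) {u w y : List A} (hu : u ∈ τ) (hw : w ∈ τ) (huy : u <:+ y)
    (hwy : w <:+ y) : u = w := by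
  rcases List.suffix_or_suffix_of_suffix huy hwy with h | h
  · exact hτ.suffixProperty w hw u hu (hτ.ne_nil u hu) h
  · exact (hτ.suffixProperty u hu w hw (hτ.ne_nil w hw) h).symm

lemma length_le_height {A : Type*} {τ : Finset (List A)} {w : List A} (hw : w ∈ τ) :
    w.length ≤ height τ :=
  Finset.le_sup (f := List.length) hw

section Compatible

variable {A Ω : Type*} [MeasurableSpace A] [MeasurableSpace Ω] {P : Measure Ω} {X : ℤ → Ω → A}

lemma measurableSet_suffix_sample [Fintype A] [MeasurableSingletonClass A]
    (hX : IsStationaryErgodic P X) (t : ℕ) (v : List A) :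
    MeasurableSet {ω | v <:+ sample (fun i => X i ω) t} :=
  measurable_sample hX t (Set.toFinite {z : Fin t → A | v <:+ List.ofFn z}).measurableSet

variable [DecidableEq A]

lemma lintegral_suffix_sample [Fintype A] [MeasurableSingletonClass A]
    (hX : IsStationaryErgodic P X) {t : ℕ} {v : List A} (h : v.length ≤ t) :
    ∫⁻ ω, (if v <:+ sample (fun i => X i ω) t then 1 else 0) ∂P = P (pastEvent X v) := by
  rw [← measure_suffix_sample hX h, ← lintegral_indicator_one (measurableSet_suffix_sample hX t v)]
  refine lintegral_congr fun ω => ?_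
  simp [Set.indicator_apply]

variable {T : ProbContextTree A}

/-- Every past that is long enough and has positive probability extends exactly one context, so the
event that `w` is followed by `a` splits according to the contexts that end with `w`. -/
lemma measure_pastEvent_append_eq_sum [Fintype A] [MeasurableSingletonClass A]
    (hX : IsCompatible P X T) {w : List A} (hw : ∃ v ∈ T.tree, w <:+ v) (a : A) :
    P (pastEvent X (w ++ [a])) = ∑ v ∈ T.tree with w <:+ v, P (pastEvent X (v ++ [a])) := by
  obtain ⟨v₀, hv₀, hwv₀⟩ := hw
  have hS := hX.stationaryErgodic
  have hlen : ∀ v ∈ T.tree, (v ++ [a]).length ≤ height T.tree + 1 := by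
    intro v hv
    simpa using length_le_height hv
  rw [← lintegral_suffix_sample hS (t := height T.tree + 1) (v := w ++ [a])
      (by simpa using hwv₀.length_le.trans (length_le_height hv₀)),
    Finset.sum_congr rfl fun v hv =>
      (lintegral_suffix_sample hS (hlen v (Finset.mem_filter.1 hv).1)).symm,
    ← lintegral_finsetSum']
  · refine lintegral_congr_ae ?_
    filter_upwards [ae_measure_pastEvent_sample_ne_zero hS] with ω hω
    obtain ⟨⟨v, hv⟩, hvs, -⟩ := hX.cond_eq _ (by rw [length_sample]) (hω (height T.tree))
    dsimp only at hvs
    simp only [append_singleton_suffix_sample_succ]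
    by_cases hws : w <:+ sample (fun i => X i ω) (height T.tree)
    · have hwv : w <:+ v := by
        rcases List.suffix_or_suffix_of_suffix hws hvs with h | h
        · exact h
        · rw [T.irreducible.eq_of_suffix hv hv₀ (h.trans hwv₀) List.suffix_rfl]
          exact hwv₀
      rw [Finset.sum_eq_single v]
      · simp [hws, hvs]
      · intro u hu huv
        rw [if_neg]
        rintro ⟨h, -⟩
        exact huv (T.irreducible.eq_of_suffix (Finset.mem_filter.1 hu).1 hv h hvs)
      · intro h
        exact absurd (Finset.mem_filter.2 ⟨hv, hwv⟩) h
    · rw [if_neg (fun h => hws h.1), Finset.sum_eq_zero]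
      intro u hu
      rw [if_neg]
      rintro ⟨h, -⟩
      exact hws ((Finset.mem_filter.1 hu).2.trans h)
  · intro v _
    exact (Measurable.ite (measurableSet_suffix_sample hS _ _) measurable_const
      measurable_const).aemeasurable

lemma measure_pastEvent_context_append [Fintype A] [MeasurableSingletonClass A]
    [IsProbabilityMeasure P] (hX : IsCompatible P X T) (v : {w : List A // w ∈ T.tree}) (a : A) :
    P (pastEvent X (v.1 ++ [a])) = T.prob v a * P (pastEvent X v.1) := by
  have hS := hX.stationaryErgodic
  have hl := length_le_height v.2
  rw [← lintegral_suffix_sample hS (t := height T.tree + 1) (v := v.1 ++ [a]) (by simpa using hl),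
    ← lintegral_suffix_sample hS hl]
  simp only [append_singleton_suffix_sample_succ]
  rw [lintegral_sample_next hS (height T.tree)
      (fun y b => if v.1 <:+ y ∧ b = a then (1 : ENNReal) else 0),
    lintegral_sample hS (height T.tree) (fun y => if v.1 <:+ y then (1 : ENNReal) else 0),
    Finset.mul_sum]
  refine Finset.sum_congr rfl fun z _ => ?_
  rw [Finset.sum_eq_single a (fun b _ hb => by simp [hb]) (by simp)]
  by_cases hvz : v.1 <:+ List.ofFn z
  · by_cases hz : P (pastEvent X (List.ofFn z)) = 0
    · simp [hz]
    · obtain ⟨u, hu, hc⟩ := hX.cond_eq (List.ofFn z) (by simp) hz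
      have huv : u = v := Subtype.ext (T.irreducible.eq_of_suffix u.2 v.2 hu hvz)
      rw [hc, huv]
      simp [hvz]
  · simp [hvz]

/-- Minimality of `τ*`: the contexts that end with a proper suffix `w` of a context do not all have
the same transition probabilities. -/
lemma exists_prob_ne (hX : IsCompatible P X T) {v w : List A} (hv : v ∈ T.tree) (hw : w ≠ [])
    (hwv : w <:+ v) (hne : w ≠ v) :
    ∃ (v' : List A) (hv' : v' ∈ T.tree), w <:+ v' ∧ ∃ a,
      T.prob ⟨v', hv'⟩ a ≠ T.prob ⟨v, hv⟩ a := by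
  have h := hX.minimal v hv w hw hwv hne
  push Not at h
  obtain ⟨x, hx, hwx, hxP, a, ha⟩ := h (T.prob ⟨v, hv⟩)
  obtain ⟨⟨v', hv'⟩, hvx, hc⟩ := hX.cond_eq x hx hxP
  refine ⟨v', hv', ?_, a, by rw [← hc]; exact ha⟩
  rcases List.suffix_or_suffix_of_suffix hwx hvx with h | h
  · exact h
  · have := T.irreducible.eq_of_suffix hv' hv (h.trans hwv) List.suffix_rfl
    subst this
    exact hwv

end Compatible

/-! ### Entropies of trees -/

section Entropy

variable {A : Type*} [Fintype A]

/-- For `r = m p` with `p` a probability vector, this is `-m` times the entropy of `p`. -/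
noncomputable def negEntropy (r : A → ℝ) : ℝ :=
  ∑ a, r a * Real.log (r a) - (∑ a, r a) * Real.log (∑ a, r a)

lemma negEntropy_const_mul {D : ℝ} (hD : 0 < D) (r : A → ℝ) :
    negEntropy (fun a => D * r a) = D * negEntropy r := by
  have h : ∀ s : ℝ, D * s * Real.log (D * s) = D * (s * Real.log s) + s * (D * Real.log D) := by
    intro s
    rcases eq_or_ne s 0 with rfl | hs
    · simp
    · rw [Real.log_mul hD.ne' hs]
      ring
  unfold negEntropy
  rw [← Finset.mul_sum, h]
  simp_rw [h]
  rw [Finset.sum_add_distrib, ← Finset.mul_sum, ← Finset.sum_mul]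
  ring

lemma continuous_negEntropy : Continuous (negEntropy : (A → ℝ) → ℝ) := by
  unfold negEntropy
  refine Continuous.sub (continuous_finsetSum _ fun a _ => ?_) ?_
  · exact Real.continuous_mul_log.comp (continuous_apply a)
  · exact Real.continuous_mul_log.comp (continuous_finsetSum _ fun a _ => continuous_apply a)

lemma negEntropy_of_sum_eq_one {r : A → ℝ} (h : ∑ a, r a = 1) :
    negEntropy r = ∑ a, r a * Real.log (r a) := by
  simp [negEntropy, h]

lemma sum_toReal_prob (p : PMF A) : ∑ a, (p a).toReal = 1 := by
  rw [← ENNReal.toReal_sum fun a _ => p.apply_ne_top a, (tsum_fintype _).symm.trans p.tsum_coe,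
    ENNReal.toReal_one]

variable {ι : Type*} {s : Finset ι} {m : ι → ℝ} {p : ι → A → ℝ}

lemma negEntropy_mixture_eq (hs : s.Nonempty) (hm : ∀ i ∈ s, 0 < m i)
    (hp1 : ∀ i ∈ s, ∑ a, p i a = 1) :
    negEntropy (fun a => ∑ i ∈ s, m i * p i a)
      = (∑ i ∈ s, m i) * ∑ a, (∑ i ∈ s, (m i / ∑ j ∈ s, m j) • p i a) *
          Real.log (∑ i ∈ s, (m i / ∑ j ∈ s, m j) • p i a) := by
  have hM : 0 < ∑ i ∈ s, m i := Finset.sum_pos hm hs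
  rw [← negEntropy_of_sum_eq_one, ← negEntropy_const_mul hM]
  · congr 1
    funext a
    rw [Finset.mul_sum]
    refine Finset.sum_congr rfl fun i _ => ?_
    rw [smul_eq_mul]
    field_simp
  · rw [Finset.sum_comm]
    simp_rw [← Finset.smul_sum]
    rw [Finset.sum_congr rfl fun i hi => by rw [hp1 i hi], ← Finset.sum_smul, ← Finset.sum_div,
      div_self hM.ne', one_smul]

lemma sum_negEntropy_eq (hs : s.Nonempty) (hm : ∀ i ∈ s, 0 < m i)
    (hp1 : ∀ i ∈ s, ∑ a, p i a = 1) :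
    ∑ i ∈ s, negEntropy (fun a => m i * p i a)
      = (∑ i ∈ s, m i) * ∑ a, ∑ i ∈ s, (m i / ∑ j ∈ s, m j) • (p i a * Real.log (p i a)) := by
  have hM : 0 < ∑ i ∈ s, m i := Finset.sum_pos hm hs
  rw [Finset.sum_comm, Finset.mul_sum]
  refine Finset.sum_congr rfl fun i hi => ?_
  rw [negEntropy_const_mul (hm i hi), negEntropy_of_sum_eq_one (hp1 i hi), ← Finset.smul_sum,
    smul_eq_mul]
  field_simp

/-- Concavity of the entropy: merging contexts does not decrease it. -/
lemma negEntropy_mixture_le (hs : s.Nonempty) (hm : ∀ i ∈ s, 0 < m i)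
    (hp : ∀ i ∈ s, ∀ a, 0 ≤ p i a) (hp1 : ∀ i ∈ s, ∑ a, p i a = 1) :
    negEntropy (fun a => ∑ i ∈ s, m i * p i a) ≤ ∑ i ∈ s, negEntropy fun a => m i * p i a := by
  have hM : 0 < ∑ i ∈ s, m i := Finset.sum_pos hm hs
  rw [negEntropy_mixture_eq hs hm hp1, sum_negEntropy_eq hs hm hp1]
  refine mul_le_mul_of_nonneg_left (Finset.sum_le_sum fun a _ => ?_) hM.le
  exact Real.convexOn_mul_log.map_sum_le (fun i hi => (div_pos (hm i hi) hM).le)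
    (by rw [← Finset.sum_div, div_self hM.ne']) (fun i hi => hp i hi a)

lemma negEntropy_mixture_lt (hm : ∀ i ∈ s, 0 < m i)
    (hp : ∀ i ∈ s, ∀ a, 0 ≤ p i a) (hp1 : ∀ i ∈ s, ∑ a, p i a = 1)
    (hne : ∃ i ∈ s, ∃ j ∈ s, ∃ a, p i a ≠ p j a) :
    negEntropy (fun a => ∑ i ∈ s, m i * p i a) < ∑ i ∈ s, negEntropy fun a => m i * p i a := by
  obtain ⟨i, hi, j, hj, a, hija⟩ := hne
  have hs : s.Nonempty := ⟨i, hi⟩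
  have hM : 0 < ∑ i ∈ s, m i := Finset.sum_pos hm hs
  have hw : ∀ i ∈ s, 0 < m i / ∑ j ∈ s, m j := fun i hi => div_pos (hm i hi) hM
  have hw1 : ∑ i ∈ s, m i / ∑ j ∈ s, m j = 1 := by rw [← Finset.sum_div, div_self hM.ne']
  rw [negEntropy_mixture_eq hs hm hp1, sum_negEntropy_eq hs hm hp1]
  refine mul_lt_mul_of_pos_left (Finset.sum_lt_sum (fun b _ => ?_) ⟨a, Finset.mem_univ a, ?_⟩) hM
  · exact Real.convexOn_mul_log.map_sum_le (fun i hi => (hw i hi).le) hw1 fun i hi => hp i hi b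
  · exact Real.strictConvexOn_mul_log.map_sum_lt hw hw1 (fun i hi => hp i hi a)
      ⟨i, hi, j, hj, hija⟩

end Entropy

/-! ### Asymptotics of the likelihood of a fixed tree -/

section Likelihood

/-- The frequencies in the window `(d n, n]` converge to the same limits as those in `(0, n]`,
because the window contains a positive fraction of the times. -/
lemma tendsto_count_window {A : Type*} [DecidableEq A] {x : ℤ → A} {v : List A} {m θ : ℝ}
    {d : ℕ → ℕ} (hθ : θ < 1)
    (h : Tendsto (fun n : ℕ => (count 0 n x v : ℝ) / n) atTop (nhds m))
    (hd : Tendsto d atTop atTop) (hdθ : ∀ᶠ n in atTop, (d n : ℝ) ≤ θ * n) :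
    Tendsto (fun n : ℕ => (count (d n) n x v : ℝ) / (n - d n : ℝ)) atTop (nhds m) := by
  have key : ∀ ε > 0, ∀ᶠ n : ℕ in atTop, |(count 0 n x v : ℝ) - m * n| ≤ ε * n := by
    intro ε hε
    filter_upwards [Metric.tendsto_nhds.1 h ε hε, eventually_gt_atTop 0] with n hn hn0
    have hn' : (0 : ℝ) < n := by exact_mod_cast hn0
    rw [Real.dist_eq] at hn
    have : (count 0 n x v : ℝ) - m * n = ((count 0 n x v : ℝ) / n - m) * n := by field_simp
    rw [this, abs_mul, abs_of_pos hn']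
    exact mul_le_mul_of_nonneg_right hn.le hn'.le
  rw [Metric.tendsto_nhds]
  intro ε hε
  have hδ : 0 < ε * (1 - θ) / 4 := by
    have := sub_pos.2 hθ
    positivity
  filter_upwards [key _ hδ, hd.eventually (key _ hδ), hdθ, eventually_gt_atTop 0]
    with n h1 h2 h3 hn0
  have hn' : (0 : ℝ) < n := by exact_mod_cast hn0
  have hgap : (1 - θ) * n ≤ n - d n := by linarith
  have hpos : 0 < (1 - θ) * n := mul_pos (sub_pos.2 hθ) hn'
  have hdn : (d n : ℝ) ≤ n := by linarith
  have hsub := count_eq_sub (Nat.cast_le.1 hdn) x v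
  rw [Real.dist_eq, hsub,
    show ((count 0 n x v : ℝ) - count 0 (d n) x v) / (n - d n) - m
      = (((count 0 n x v : ℝ) - m * n) - (count 0 (d n) x v - m * d n)) / (n - d n) by
      have : (n : ℝ) - d n ≠ 0 := by linarith
      field_simp
      ring,
    abs_div, abs_of_pos (hpos.trans_le hgap), div_lt_iff₀ (hpos.trans_le hgap)]
  have h4 : ε * (1 - θ) / 4 * d n ≤ ε * (1 - θ) / 4 * n :=
    mul_le_mul_of_nonneg_left hdn hδ.le
  have h5 : ε * ((1 - θ) * n) ≤ ε * (n - d n) := mul_le_mul_of_nonneg_left hgap hε.le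
  have h6 : 0 < ε * ((1 - θ) * n) := mul_pos hε hpos
  have h7 := abs_sub ((count 0 n x v : ℝ) - m * n) (count 0 (d n) x v - m * d n)
  linarith

variable {A : Type*} [Fintype A] [DecidableEq A]

lemma count_le_countCtx (d n : ℕ) (x : ℤ → A) (w : List A) (a : A) :
    count d n x (w ++ [a]) ≤ countCtx d n x w :=
  Finset.single_le_sum (f := fun b => count d n x (w ++ [b])) (fun _ _ => Nat.zero_le _)
    (Finset.mem_univ a)

lemma phat_nonneg (d n : ℕ) (x : ℤ → A) (w : List A) (a : A) : 0 ≤ phat d n x w a := by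
  unfold phat
  positivity

lemma phat_pow_count_pos (d n : ℕ) (x : ℤ → A) (w : List A) (a : A) :
    0 < phat d n x w a ^ count d n x (w ++ [a]) := by
  rcases Nat.eq_zero_or_pos (count d n x (w ++ [a])) with h | h
  · simp [h]
  · have := h.trans_le (count_le_countCtx d n x w a)
    unfold phat
    positivity

lemma likelihood_pos (d n : ℕ) (x : ℤ → A) (τ : Finset (List A)) : 0 < likelihood d n x τ :=
  Finset.prod_pos fun _ _ => Finset.prod_pos fun _ _ => phat_pow_count_pos _ _ _ _ _

lemma log_likelihood_eq (d n : ℕ) (x : ℤ → A) (τ : Finset (List A)) :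
    Real.log (likelihood d n x τ)
      = ∑ w ∈ τ, negEntropy fun a => (count d n x (w ++ [a]) : ℝ) := by
  unfold likelihood
  rw [Real.log_prod fun _ _ => (Finset.prod_pos fun _ _ => phat_pow_count_pos _ _ _ _ _).ne']
  refine Finset.sum_congr rfl fun w _ => ?_
  rw [Real.log_prod fun _ _ => (phat_pow_count_pos _ _ _ _ _).ne']
  unfold negEntropy
  rw [Finset.sum_mul, ← Finset.sum_sub_distrib]
  refine Finset.sum_congr rfl fun a _ => ?_
  rw [Real.log_pow]
  rcases Nat.eq_zero_or_pos (count d n x (w ++ [a])) with h | h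
  · simp [h]
  · have h2 := h.trans_le (count_le_countCtx d n x w a)
    unfold phat
    rw [Real.log_div (by positivity) (by positivity), mul_sub]
    simp [countCtx]

lemma tendsto_logLik_div {x : ℤ → A} {m : List A → ℝ} {θ : ℝ} {d : ℕ → ℕ} (hθ : θ < 1)
    (h : ∀ v, Tendsto (fun n : ℕ => (count 0 n x v : ℝ) / n) atTop (nhds (m v)))
    (hd : Tendsto d atTop atTop) (hdθ : ∀ᶠ n in atTop, (d n : ℝ) ≤ θ * n)
    (τ : Finset (List A)) :
    Tendsto (fun n : ℕ => logLik d n x τ / (n - d n : ℝ)) atTop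
      (nhds (∑ w ∈ τ, negEntropy fun a => m (w ++ [a]))) := by
  have h1 : Tendsto (fun n : ℕ => ∑ w ∈ τ, negEntropy fun a =>
      (count (d n) n x (w ++ [a]) : ℝ) / (n - d n : ℝ)) atTop
      (nhds (∑ w ∈ τ, negEntropy fun a => m (w ++ [a]))) := by
    refine tendsto_finsetSum _ fun w _ => (continuous_negEntropy.tendsto _).comp ?_
    rw [tendsto_pi_nhds]
    exact fun a => tendsto_count_window hθ (h _) hd hdθ
  refine h1.congr' ?_
  filter_upwards [hdθ, eventually_gt_atTop 0] with n h3 hn0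
  have hn' : (0 : ℝ) < n := by exact_mod_cast hn0
  have hpos : 0 < (1 - θ) * n := mul_pos (sub_pos.2 hθ) hn'
  have hD : 0 < (n : ℝ) - d n := by linarith
  unfold logLik
  rw [log_likelihood_eq, Finset.sum_div]
  refine Finset.sum_congr rfl fun w _ => ?_
  rw [div_eq_inv_mul, ← negEntropy_const_mul (inv_pos.2 hD)]
  simp_rw [div_eq_inv_mul]

end Likelihood

/-! ### Trees smaller than the context tree -/

section Compatible

variable {A Ω : Type*} [Fintype A] [DecidableEq A] [MeasurableSpace A] [MeasurableSpace Ω]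
  {P : Measure Ω} {X : ℤ → Ω → A} {T : ProbContextTree A}

/-- The almost sure limit of the normalized log-likelihood of `τ`: minus the conditional entropy
of `X_0` given the context in `τ` of the past. -/
noncomputable def limitLogLik (P : Measure Ω) (X : ℤ → Ω → A) (τ : Finset (List A)) : ℝ :=
  ∑ w ∈ τ, negEntropy fun a => P.real (pastEvent X (w ++ [a]))

/-- A strictly smaller tree merges contexts with different transition probabilities, hence loses
entropy. -/
lemma limitLogLik_lt [MeasurableSingletonClass A] [IsProbabilityMeasure P]
    (hX : IsCompatible P X T) {τ : Finset (List A)} (hτ : IsIrreducibleTree τ)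
    (hsub : ∀ w ∈ τ, ∃ v ∈ T.tree, w <:+ v) (hlt : TreeLT τ T.tree) :
    limitLogLik P X τ < limitLogLik P X T.tree := by
  have hsplit : ∀ F : List A → ℝ,
      ∑ v ∈ T.tree, F v = ∑ w ∈ τ, ∑ v ∈ T.tree with w <:+ v, F v := by
    intro F
    simp_rw [Finset.sum_filter]
    rw [Finset.sum_comm]
    refine Finset.sum_congr rfl fun v hv => ?_
    obtain ⟨w, hw, hwv⟩ := hlt.1 v hv
    rw [Finset.sum_eq_single w, if_pos hwv]
    · intro u hu huw
      exact if_neg fun h => huw (hτ.eq_of_suffix hu hw h hwv)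
    · exact fun h => absurd hw h
  -- transition probabilities and weights of the contexts
  let p : List A → A → ℝ := fun v a => if hv : v ∈ T.tree then (T.prob ⟨v, hv⟩ a).toReal else 0
  let m : List A → ℝ := fun v => P.real (pastEvent X v)
  have hm : ∀ v ∈ T.tree, 0 < m v := fun v hv =>
    ENNReal.toReal_pos (hX.context_pos v hv) (measure_ne_top _ _)
  have hp : ∀ v ∈ T.tree, ∀ a, 0 ≤ p v a := fun v hv a => by simp [p, hv]
  have hp1 : ∀ v ∈ T.tree, ∑ a, p v a = 1 := fun v hv => by
    simp only [p, hv, dite_true]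
    exact sum_toReal_prob _
  have hmp : ∀ v ∈ T.tree, ∀ a, P.real (pastEvent X (v ++ [a])) = m v * p v a := by
    intro v hv a
    simp only [p, m, hv, dite_true, Measure.real]
    rw [measure_pastEvent_context_append hX ⟨v, hv⟩ a, ENNReal.toReal_mul, mul_comm]
  have hmix : ∀ w ∈ τ, ∀ a, P.real (pastEvent X (w ++ [a]))
      = ∑ v ∈ T.tree with w <:+ v, m v * p v a := by
    intro w hw a
    rw [Measure.real, measure_pastEvent_append_eq_sum hX (hsub w hw),
      ENNReal.toReal_sum fun _ _ => measure_ne_top _ _]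
    exact Finset.sum_congr rfl fun v hv => hmp v (Finset.mem_filter.1 hv).1 a
  have hmem : ∀ {w v}, v ∈ T.tree.filter (w <:+ ·) → v ∈ T.tree := fun h =>
    (Finset.mem_filter.1 h).1
  have hT : limitLogLik P X T.tree
      = ∑ w ∈ τ, ∑ v ∈ T.tree with w <:+ v, negEntropy fun a => m v * p v a := by
    rw [← hsplit]
    refine Finset.sum_congr rfl fun v hv => ?_
    simp_rw [hmp v hv]
  have hτ' : limitLogLik P X τ
      = ∑ w ∈ τ, negEntropy fun a => ∑ v ∈ T.tree with w <:+ v, m v * p v a := by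
    refine Finset.sum_congr rfl fun w hw => ?_
    simp_rw [hmix w hw]
  -- if no string of `τ` were a proper suffix of a context, then `τ` would be equal to `τ*`
  have hstrict : ∃ w ∈ τ, ∃ v ∈ T.tree, w <:+ v ∧ w ≠ v := by
    by_contra hcon
    push Not at hcon
    refine hlt.2 (Finset.Subset.antisymm (fun w hw => ?_) fun v hv => ?_)
    · obtain ⟨v, hv, hwv⟩ := hsub w hw
      exact hcon w hw v hv hwv ▸ hv
    · obtain ⟨w, hw, hwv⟩ := hlt.1 v hv
      exact hcon w hw v hv hwv ▸ hw
  rw [hT, hτ']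
  refine Finset.sum_lt_sum (fun w hw => ?_) ?_
  · obtain ⟨v, hv, hwv⟩ := hsub w hw
    exact negEntropy_mixture_le ⟨v, Finset.mem_filter.2 ⟨hv, hwv⟩⟩ (fun v hv => hm v (hmem hv))
      (fun v hv => hp v (hmem hv)) fun v hv => hp1 v (hmem hv)
  · obtain ⟨w, hw, v, hv, hwv, hne⟩ := hstrict
    obtain ⟨v', hv', hwv', a, ha⟩ := exists_prob_ne hX hv (hτ.ne_nil w hw) hwv hne
    refine ⟨w, hw, negEntropy_mixture_lt (fun v hv => hm v (hmem hv))
      (fun v hv => hp v (hmem hv)) (fun v hv => hp1 v (hmem hv))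
      ⟨v', Finset.mem_filter.2 ⟨hv', hwv'⟩, v, Finset.mem_filter.2 ⟨hv, hwv⟩, a, ?_⟩⟩
    simp only [p, hv, hv', dite_true]
    exact fun h => ha ((ENNReal.toReal_eq_toReal_iff' (PMF.apply_ne_top _ _)
      (PMF.apply_ne_top _ _)).1 h)

/-- In a tree `τ ≼ τ*` of observed strings, every string is a suffix of a context: it cannot have a
context as a proper suffix, since that context has in turn a suffix in `τ`. -/
lemma exists_context_of_observed (hX : IsCompatible P X T) {τ : Finset (List A)} {x : ℤ → A}
    {d n : ℕ} (hpos : ∀ t : ℕ, P (pastEvent X (sample x t)) ≠ 0) (hd : height T.tree ≤ d)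
    (hτ : τ ∈ candidates d n x) (hle : TreeLE τ T.tree) {w : List A} (hw : w ∈ τ) :
    ∃ v ∈ T.tree, w <:+ v := by
  have h := hτ.2.2.1 w hw
  rw [countCtx_eq, Finset.card_pos] at h
  obtain ⟨s, hs⟩ := h
  rw [Finset.mem_filter, Finset.mem_Ico] at hs
  obtain ⟨⟨v, hv⟩, hvs, -⟩ := hX.cond_eq (sample x s) (by rw [length_sample]; omega) (hpos s)
  rcases List.suffix_or_suffix_of_suffix hs.2 hvs with h | h
  · exact ⟨v, hv, h⟩
  · obtain ⟨u, hu, huv⟩ := hle v hv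
    rw [← hτ.1.eq_of_suffix hu hw (huv.trans h) List.suffix_rfl]
    exact ⟨v, hv, huv⟩

/-- Almost surely, for large `n`, the log-likelihood of every candidate tree below `τ*` falls short by
at least a fixed multiple of `n`. Only the finitely many sets of suffixes of contexts are
concerned, so the convergence is uniform in `τ`. -/
lemma ae_eventually_underfit [MeasurableSingletonClass A] [IsProbabilityMeasure P]
    (hX : IsCompatible P X T) {θ : ℝ} (hθ : θ < 1) {d : ℕ → ℕ}
    (hd : Tendsto d atTop atTop) (hdθ : ∀ᶠ n in atTop, (d n : ℝ) ≤ θ * n) :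
    ∀ᵐ ω ∂P, ∀ᶠ n : ℕ in atTop, ∀ τ ∈ candidates (d n) n (fun t => X t ω), TreeLT τ T.tree →
      0 < limitLogLik P X T.tree - limitLogLik P X τ ∧
      (1 - θ) * (limitLogLik P X T.tree - limitLogLik P X τ) / 2 * n
        ≤ logLik d n (fun t => X t ω) T.tree - logLik d n (fun t => X t ω) τ := by
  filter_upwards [ae_measure_pastEvent_sample_ne_zero hX.stationaryErgodic,
    ae_tendsto_count_div hX.stationaryErgodic] with ω hpos hcount
  have hlim := tendsto_logLik_div hθ hcount hd hdθ
  let U : Finset (List A) := T.tree.biUnion fun v => v.tails.toFinset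
  have hU : ∀ᶠ n : ℕ in atTop, ∀ τ ∈ U.powerset,
      0 < limitLogLik P X T.tree - limitLogLik P X τ →
      (1 - θ) * (limitLogLik P X T.tree - limitLogLik P X τ) / 2 * n
        ≤ logLik d n (fun t => X t ω) T.tree - logLik d n (fun t => X t ω) τ := by
    rw [eventually_all_finset]
    intro τ _
    by_cases hgap : 0 < limitLogLik P X T.tree - limitLogLik P X τ
    swap
    · exact Eventually.of_forall fun n h => absurd h hgap
    have hev := ((hlim T.tree).sub (hlim τ)).eventually_const_lt (half_lt_self hgap)
    filter_upwards [hev, hdθ, eventually_gt_atTop 0] with n h1 h3 hn0 _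
    have hn' : (0 : ℝ) < n := by exact_mod_cast hn0
    have hpos : 0 < (1 - θ) * n := mul_pos (sub_pos.2 hθ) hn'
    have hD : 0 < (n : ℝ) - d n := by linarith
    rw [← sub_div, lt_div_iff₀ hD] at h1
    have h4 : (1 - θ) * n ≤ n - d n := by linarith
    have h5 := mul_le_mul_of_nonneg_left h4 (half_pos hgap).le
    change (limitLogLik P X T.tree - limitLogLik P X τ) / 2 * _ < _ at h1
    linarith
  filter_upwards [hU, hd.eventually_ge_atTop (height T.tree)] with n h1 h2 τ hτ hlt
  have hsub : ∀ w ∈ τ, ∃ v ∈ T.tree, w <:+ v := fun w hw =>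
    exists_context_of_observed hX hpos h2 hτ hlt.1 hw
  have hgap := sub_pos.2 (limitLogLik_lt hX hτ.1 hsub hlt)
  refine ⟨hgap, h1 τ (Finset.mem_powerset.2 fun w hw => ?_) hgap⟩
  obtain ⟨v, hv, hwv⟩ := hsub w hw
  exact Finset.mem_biUnion.2 ⟨v, hv, by simpa using hwv⟩

end Compatible

/-! ### The likelihood of trees larger than the context tree: lower bound -/

section Gibbs

variable {A : Type*} [Fintype A]

/-- Gibbs' inequality: empirical frequencies maximize the likelihood. -/
lemma prod_pow_le_prod_freq_pow (c : A → ℕ) {q : A → ℝ} (hq : ∀ a, 0 ≤ q a)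
    (hq1 : ∑ a, q a ≤ 1) :
    ∏ a, q a ^ c a ≤ ∏ a, ((c a : ℝ) / ∑ b, (c b : ℝ)) ^ c a := by
  set S : ℝ := ∑ b, (c b : ℝ) with hS
  have hS0 : 0 ≤ S := Finset.sum_nonneg fun _ _ => Nat.cast_nonneg _
  have key : ∀ a, q a ^ c a ≤ ((c a : ℝ) / S) ^ c a * Real.exp (q a * S - c a) := by
    intro a
    rcases Nat.eq_zero_or_pos (c a) with h | h
    · rw [h]
      simpa using mul_nonneg (hq a) hS0
    have hc : (0 : ℝ) < c a := by exact_mod_cast h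
    have hSp : 0 < S := hc.trans_le
      (Finset.single_le_sum (f := fun b => (c b : ℝ)) (fun _ _ => Nat.cast_nonneg _)
        (Finset.mem_univ a))
    have h1 := Real.add_one_le_exp (q a * S / c a - 1)
    rw [sub_add_cancel] at h1
    have h2 : q a ≤ (c a : ℝ) / S * Real.exp (q a * S / c a - 1) := by
      calc q a = (c a : ℝ) / S * (q a * S / c a) := by field_simp
        _ ≤ _ := mul_le_mul_of_nonneg_left h1 (by positivity)
    calc q a ^ c a ≤ ((c a : ℝ) / S * Real.exp (q a * S / c a - 1)) ^ c a :=
          pow_le_pow_left₀ (hq a) h2 _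
      _ = ((c a : ℝ) / S) ^ c a * Real.exp (q a * S - c a) := by
          rw [mul_pow, ← Real.exp_nat_mul]
          congr 2
          field_simp
  calc ∏ a, q a ^ c a ≤ ∏ a, (((c a : ℝ) / S) ^ c a * Real.exp (q a * S - c a)) :=
        Finset.prod_le_prod (fun a _ => pow_nonneg (hq a) _) fun a _ => key a
    _ = (∏ a, ((c a : ℝ) / S) ^ c a) * Real.exp ((∑ a, q a) * S - S) := by
        rw [Finset.prod_mul_distrib, ← Real.exp_sum, Finset.sum_sub_distrib, Finset.sum_mul]
    _ ≤ (∏ a, ((c a : ℝ) / S) ^ c a) * 1 := by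
        refine mul_le_mul_of_nonneg_left ?_ (Finset.prod_nonneg fun a _ => by positivity)
        rw [Real.exp_le_one_iff]
        nlinarith
    _ = _ := mul_one _

end Gibbs

section Overfit

variable {A : Type*} [Fintype A] [DecidableEq A]

/-- Each past that is used in the counts has a context in a candidate tree, because it is at least
as long as the tree is high. -/
lemma exists_suffix_sample_of_candidate {d n : ℕ} {x : ℤ → A} {τ : Finset (List A)}
    (hτ : τ ∈ candidates d n x) {s : ℕ} (hs : s ∈ Finset.Ico d n) :
    ∃ w ∈ τ, w <:+ sample x s := by
  have hpos : 0 < countCtx d n x (sample x s) := by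
    rw [countCtx_eq, Finset.card_pos]
    exact ⟨s, Finset.mem_filter.2 ⟨hs, List.suffix_rfl⟩⟩
  rcases hτ.2.2.2 _ hpos with h | ⟨w, hw, hsw⟩
  · exact h
  · refine ⟨w, hw, ?_⟩
    have h1 := (length_le_height hw).trans hτ.2.1
    have h2 := (Finset.mem_Ico.1 hs).1
    rw [hsw.eq_of_length_le (by rw [length_sample]; omega)]

lemma likelihood_eq_prod_times (d n : ℕ) (x : ℤ → A) (τ : Finset (List A)) :
    likelihood d n x τ
      = ∏ s ∈ Finset.Ico d n, ∏ w ∈ τ with w <:+ sample x s, phat d n x w (x (s + 1)) :=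
  prod_pow_count d n x τ _

variable {Ω : Type*} [MeasurableSpace A] [MeasurableSpace Ω] {P : Measure Ω} {X : ℤ → Ω → A}
  {T : ProbContextTree A}

/-- The likelihood of a candidate tree `τ ≽ τ*` is at least the conditional probability of the
sample given its first `d` symbols. -/
lemma prod_cond_le_likelihood (hX : IsCompatible P X T) {d n : ℕ} {x : ℤ → A}
    (hpos : ∀ t : ℕ, P (pastEvent X (sample x t)) ≠ 0) (hd : height T.tree ≤ d)
    {τ : Finset (List A)} (hτ : τ ∈ candidates d n x) (hle : TreeLE T.tree τ) :
    ∏ s ∈ Finset.Ico d n, (P[presentEvent X (x (s + 1)) | pastEvent X (sample x s)]).toReal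
      ≤ likelihood d n x τ := by
  choose! u hu huv using hle
  let q : List A → A → ℝ := fun v a =>
    if hv : u v ∈ T.tree then (T.prob ⟨u v, hv⟩ a).toReal else 0
  have h1 : ∏ s ∈ Finset.Ico d n,
      (P[presentEvent X (x (s + 1)) | pastEvent X (sample x s)]).toReal
      = ∏ s ∈ Finset.Ico d n, ∏ v ∈ τ with v <:+ sample x s, q v (x (s + 1)) := by
    refine Finset.prod_congr rfl fun s hs => ?_
    obtain ⟨v, hv, hvs⟩ := exists_suffix_sample_of_candidate hτ hs
    have hf : τ.filter (· <:+ sample x s) = {v} := by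
      ext w
      rw [Finset.mem_filter, Finset.mem_singleton]
      exact ⟨fun h => hτ.1.eq_of_suffix h.1 hv h.2 hvs, by rintro rfl; exact ⟨hv, hvs⟩⟩
    rw [hf, Finset.prod_singleton]
    obtain ⟨w, hw, hc⟩ := hX.cond_eq (sample x s)
      (by rw [length_sample]; exact hd.trans (Finset.mem_Ico.1 hs).1) (hpos s)
    have hwu : w = ⟨u v, hu v hv⟩ :=
      Subtype.ext (T.irreducible.eq_of_suffix w.2 (hu v hv) hw ((huv v hv).trans hvs))
    rw [hc, hwu]
    simp [q, hu v hv]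
  rw [h1, ← prod_pow_count]
  unfold likelihood
  have hq0 : ∀ v a, 0 ≤ q v a := by
    intro v a
    simp only [q]
    split_ifs <;> simp
  refine Finset.prod_le_prod (fun v _ => Finset.prod_nonneg fun a _ => pow_nonneg (hq0 v a) _)
    fun v hv => ?_
  refine (prod_pow_le_prod_freq_pow _ (hq0 v) ?_).trans_eq ?_
  · simp only [q, hu v hv, dite_true]
    exact (sum_toReal_prob _).le
  · simp [phat, countCtx]

end Overfit

/-! ### The likelihood of trees larger than the context tree: upper bound -/

section Supermartingale

/-- A product over times before `n` is a function of the sample of size `n`. -/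
lemma exists_prod_eq_sample {A : Type*} (F : List A → A → ENNReal) (d n : ℕ) :
    ∃ h : List A → ENNReal, ∀ x : ℤ → A,
      ∏ s ∈ Finset.Ico d n, F (sample x s) (x (s + 1)) = h (sample x n) := by
  have hfac : Function.FactorsThrough
      (fun x : ℤ → A => ∏ s ∈ Finset.Ico d n, F (sample x s) (x (s + 1)))
      (fun x : ℤ → A => sample x n) := by
    intro x x' hxx
    refine Finset.prod_congr rfl fun s hs => ?_
    have hsn := (Finset.mem_Ico.1 hs).2
    dsimp only at hxx
    have h1 : sample x s = sample x' s := by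
      rw [← take_sample x hsn.le, hxx, take_sample x' hsn.le]
    have h2 : sample x (s + 1) = sample x' (s + 1) := by
      rw [← take_sample x hsn, hxx, take_sample x' hsn]
    rw [sample_succ, sample_succ, h1, List.append_cancel_left_eq] at h2
    rw [h1, List.singleton_inj.1 h2]
  exact ⟨Function.extend (fun x : ℤ → A => sample x n) _ 0, fun x => (hfac.extend_apply 0 x).symm⟩

variable {A Ω : Type*} [Fintype A] [MeasurableSpace A] [MeasurableSingletonClass A]
  [MeasurableSpace Ω] {P : Measure Ω} {X : ℤ → Ω → A}

lemma measurable_prod_sample (hX : IsStationaryErgodic P X) (F : List A → A → ENNReal)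
    (d n : ℕ) :
    Measurable fun ω => ∏ s ∈ Finset.Ico d n, F (sample (fun i => X i ω) s) (X (s + 1) ω) := by
  obtain ⟨h, hh⟩ := exists_prod_eq_sample F d n
  simp_rw [hh fun i => X i _]
  exact (measurable_of_finite fun z : Fin n → A => h (List.ofFn z)).comp (measurable_sample hX n)

/-- The likelihood ratio of a predictive (sub)probability `f` with respect to the true law of the
process is a supermartingale, so its mean is at most `1`. -/
lemma lintegral_prod_ratio_le_one [IsProbabilityMeasure P] (hX : IsStationaryErgodic P X)
    {f : List A → A → ENNReal} (hf : ∀ y, ∑ a, f y a ≤ 1) (d n : ℕ) :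
    ∫⁻ ω, ∏ s ∈ Finset.Ico d n, (f (sample (fun i => X i ω) s) (X (s + 1) ω) /
      P[presentEvent X (X (s + 1) ω) | pastEvent X (sample (fun i => X i ω) s)]) ∂P ≤ 1 := by
  induction n with
  | zero => simp
  | succ n ih =>
    rcases le_or_gt d n with hdn | hdn
    swap
    · rw [Finset.Ico_eq_empty (by omega)]
      simp
    let F : List A → A → ENNReal := fun y a => f y a / P[presentEvent X a | pastEvent X y]
    obtain ⟨h, hh⟩ := exists_prod_eq_sample F d n
    have hprod : ∀ ω, ∏ s ∈ Finset.Ico d n, (f (sample (fun i => X i ω) s) (X (s + 1) ω) /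
        P[presentEvent X (X (s + 1) ω) | pastEvent X (sample (fun i => X i ω) s)])
        = h (sample (fun i => X i ω) n) := fun ω => hh fun i => X i ω
    simp_rw [Finset.prod_Ico_succ_top hdn, hprod] at ih ⊢
    refine le_trans ?_ ih
    rw [lintegral_sample_next hX n (fun y a => h y * (f y a / P[presentEvent X a | pastEvent X y])),
      lintegral_sample hX]
    refine Finset.sum_le_sum fun z _ => ?_
    generalize List.ofFn z = y
    calc ∑ a, h y * (f y a / P[presentEvent X a | pastEvent X y]) *
          (P[presentEvent X a | pastEvent X y] * P (pastEvent X y))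
        ≤ ∑ a, h y * P (pastEvent X y) * f y a := by
          refine Finset.sum_le_sum fun a _ => ?_
          calc _ = h y * P (pastEvent X y) * (P[presentEvent X a | pastEvent X y] *
                (f y a / P[presentEvent X a | pastEvent X y])) := by ring
            _ ≤ _ := by gcongr; exact ENNReal.mul_div_le
      _ ≤ h y * P (pastEvent X y) := by
          rw [← Finset.mul_sum]
          exact mul_le_of_le_one_right' (hf y)

end Supermartingale

section Types

variable {A : Type*} [Fintype A] [DecidableEq A]

/-- The predictive probability of `a` after the past `y` for a tree `τ` whose transition
probabilities are the frequencies of a table `c` of counts. It is `0` if `y` has no context in `τ`;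
if there were several contexts, their frequencies would be multiplied. -/
noncomputable def predict (τ : Finset (List A)) (c : List A → A → ℕ) (y : List A) (a : A) :
    ENNReal :=
  if ∃ w ∈ τ, w <:+ y then
    ∏ w ∈ τ with w <:+ y, ENNReal.ofReal ((c w a : ℝ) / ∑ b, (c w b : ℝ))
  else 0

lemma sum_predict_le_one (τ : Finset (List A)) (c : List A → A → ℕ) (y : List A) :
    ∑ a, predict τ c y a ≤ 1 := by
  unfold predict
  split_ifs with h
  swap
  · simp
  obtain ⟨w, hw, hwy⟩ := h
  have hle : ∀ v a, ENNReal.ofReal ((c v a : ℝ) / ∑ b, (c v b : ℝ)) ≤ 1 := by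
    intro v a
    rw [← ENNReal.ofReal_one]
    refine ENNReal.ofReal_le_ofReal (div_le_one_of_le₀ ?_ ?_)
    · exact Finset.single_le_sum (f := fun b => (c v b : ℝ)) (fun _ _ => Nat.cast_nonneg _)
        (Finset.mem_univ a)
    · exact Finset.sum_nonneg fun _ _ => Nat.cast_nonneg _
  calc ∑ a, ∏ v ∈ τ with v <:+ y, ENNReal.ofReal ((c v a : ℝ) / ∑ b, (c v b : ℝ))
      ≤ ∑ a, ENNReal.ofReal ((c w a : ℝ) / ∑ b, (c w b : ℝ)) := by
        refine Finset.sum_le_sum fun a _ => ?_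
        rw [← Finset.mul_prod_erase _ _ (Finset.mem_filter.2 ⟨hw, hwy⟩)]
        exact mul_le_of_le_one_right' (Finset.prod_le_one' fun v _ => hle v a)
    _ ≤ 1 := by
        rw [← ENNReal.ofReal_sum_of_nonneg fun _ _ => by positivity, ← Finset.sum_div,
          ← ENNReal.ofReal_one]
        exact ENNReal.ofReal_le_ofReal (div_self_le_one _)

/-- A table of counts for the contexts of `τ`, as a table for all strings. -/
def extendTable {τ : Finset (List A)} {n : ℕ} (c : τ → A → Fin (n + 1)) (w : List A) (a : A) : ℕ :=
  if hw : w ∈ τ then c ⟨w, hw⟩ a else 0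

lemma count_le {A : Type*} [DecidableEq A] (d n : ℕ) (x : ℤ → A) (v : List A) :
    count d n x v ≤ n := by
  refine (Finset.card_filter_le _ _).trans ?_
  simp

variable {Ω : Type*} [MeasurableSpace Ω]

/-- The sum over all tables of counts of the likelihood ratios of the corresponding predictive
probabilities with respect to the law of the process. -/
noncomputable def ratioSum (P : Measure Ω) (X : ℤ → Ω → A) (d n : ℕ) (τ : Finset (List A))
    (x : ℤ → A) : ENNReal :=
  ∑ c : τ → A → Fin (n + 1), ∏ s ∈ Finset.Ico d n,
    (predict τ (extendTable c) (sample x s) (x (s + 1)) /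
      P[presentEvent X (x (s + 1)) | pastEvent X (sample x s)])

variable {P : Measure Ω} {X : ℤ → Ω → A}

/-- The table of the counts of the sample is one of the tables in `ratioSum`, and its predictive
probability of the sample is the maximum likelihood. -/
lemma likelihood_le_ratioSum_mul {d n : ℕ} {x : ℤ → A} [IsProbabilityMeasure P]
    (hpos : ∀ s : ℕ, P[presentEvent X (x (s + 1)) | pastEvent X (sample x s)] ≠ 0)
    {τ : Finset (List A)} (hτ : τ ∈ candidates d n x) :
    ENNReal.ofReal (likelihood d n x τ) ≤ ratioSum P X d n τ x *
      ∏ s ∈ Finset.Ico d n, P[presentEvent X (x (s + 1)) | pastEvent X (sample x s)] := by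
  let c : τ → A → Fin (n + 1) := fun w a =>
    ⟨count d n x (w.1 ++ [a]), Nat.lt_succ_of_le (count_le d n x _)⟩
  have h1 : ENNReal.ofReal (likelihood d n x τ)
      = ∏ s ∈ Finset.Ico d n, predict τ (extendTable c) (sample x s) (x (s + 1)) := by
    rw [likelihood_eq_prod_times, ENNReal.ofReal_prod_of_nonneg
      fun s _ => Finset.prod_nonneg fun w _ => phat_nonneg _ _ _ _ _]
    refine Finset.prod_congr rfl fun s hs => ?_
    rw [predict, if_pos (exists_suffix_sample_of_candidate hτ hs),
      ENNReal.ofReal_prod_of_nonneg fun w _ => phat_nonneg _ _ _ _ _]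
    refine Finset.prod_congr rfl fun w hw => ?_
    simp [extendTable, (Finset.mem_filter.1 hw).1, c, phat, countCtx]
  have h2 : ∏ s ∈ Finset.Ico d n, predict τ (extendTable c) (sample x s) (x (s + 1))
      = (∏ s ∈ Finset.Ico d n, (predict τ (extendTable c) (sample x s) (x (s + 1)) /
        P[presentEvent X (x (s + 1)) | pastEvent X (sample x s)])) *
        ∏ s ∈ Finset.Ico d n, P[presentEvent X (x (s + 1)) | pastEvent X (sample x s)] := by
    rw [← Finset.prod_mul_distrib]
    refine Finset.prod_congr rfl fun s _ => ?_
    rw [ENNReal.div_mul_cancel (hpos s) (measure_ne_top _ _)]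
  rw [h1, h2]
  gcongr
  exact Finset.single_le_sum (f := fun c : τ → A → Fin (n + 1) => ∏ s ∈ Finset.Ico d n,
    (predict τ (extendTable c) (sample x s) (x (s + 1)) /
      P[presentEvent X (x (s + 1)) | pastEvent X (sample x s)])) (fun _ _ => bot_le)
    (Finset.mem_univ c)

variable [MeasurableSpace A]

lemma measurable_ratioSum [MeasurableSingletonClass A] (hX : IsStationaryErgodic P X) (d n : ℕ)
    (τ : Finset (List A)) : Measurable fun ω => ratioSum P X d n τ (fun i => X i ω) :=
  Finset.measurable_fun_sum _ fun c _ => measurable_prod_sample hX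
    (fun y a => predict τ (extendTable c) y a / P[presentEvent X a | pastEvent X y]) d n

lemma lintegral_ratioSum_le [IsProbabilityMeasure P] [MeasurableSingletonClass A]
    (hX : IsStationaryErgodic P X) (d n : ℕ) (τ : Finset (List A)) :
    ∫⁻ ω, ratioSum P X d n τ (fun i => X i ω) ∂P
      ≤ ENNReal.ofReal (((n : ℝ) + 1) ^ (Fintype.card A * τ.card)) := by
  unfold ratioSum
  rw [lintegral_finsetSum _ fun c _ => measurable_prod_sample hX
    (fun y a => predict τ (extendTable c) y a / P[presentEvent X a | pastEvent X y]) d n]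
  refine (Finset.sum_le_sum fun c _ =>
    lintegral_prod_ratio_le_one hX (sum_predict_le_one τ (extendTable c)) d n).trans_eq ?_
  rw [Finset.sum_const, Finset.card_univ, Fintype.card_fun, Fintype.card_fun, Fintype.card_fin,
    Fintype.card_coe, nsmul_one, ← pow_mul, ENNReal.ofReal_pow (by positivity)]
  push_cast
  rw [ENNReal.ofReal_add (by positivity) (by positivity)]
  simp

/-- Almost surely, the sums of likelihood ratios are bounded simultaneously for all sample sizes and
all trees, by a power of the sample size for each tree: the weighted sum of all of them has a finite
mean. -/
lemma ae_exists_ratioSum_le [IsProbabilityMeasure P] [MeasurableSingletonClass A]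
    (hX : IsStationaryErgodic P X) {ε : Finset (List A) → NNReal} (hε : ∀ τ, 0 < ε τ)
    (hsum : ∑' τ, (ε τ : ENNReal) < 1) (d : ℕ → ℕ) :
    ∀ᵐ ω ∂P, ∃ C : ℝ, 0 ≤ C ∧ ∀ (n : ℕ) (τ : Finset (List A)),
      ratioSum P X (d n) n τ (fun i => X i ω)
        ≤ ENNReal.ofReal (C * ((n : ℝ) + 1) ^ (Fintype.card A * τ.card + 2) / ε τ) := by
  let u : ℕ → Finset (List A) → ℝ := fun n τ =>
    ε τ / ((n : ℝ) + 1) ^ (Fintype.card A * τ.card + 2)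
  have hu : ∀ n τ, 0 < u n τ := fun n τ => by
    have : (0 : ℝ) < ε τ := hε τ
    positivity
  let G : Ω → ENNReal := fun ω => ∑' n, ∑' τ,
    ENNReal.ofReal (u n τ) * ratioSum P X (d n) n τ (fun i => X i ω)
  have hGm : Measurable G := Measurable.tsum fun n => Measurable.tsum fun τ =>
    (measurable_ratioSum hX _ _ _).const_mul _
  have hsq : ∑' n : ℕ, ENNReal.ofReal (1 / ((n : ℝ) + 1) ^ 2) ≠ ⊤ := by
    refine Summable.tsum_ofReal_ne_top ?_
    have := (summable_nat_add_iff 1).2 (Real.summable_one_div_nat_pow.2 one_lt_two)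
    simpa using this
  have hG : ∫⁻ ω, G ω ∂P ≠ ⊤ := by
    have hle : ∫⁻ ω, G ω ∂P ≤ ∑' n : ℕ, ∑' τ, ENNReal.ofReal (1 / ((n : ℝ) + 1) ^ 2) * ε τ := by
      simp only [G]
      rw [lintegral_tsum fun n => (Measurable.tsum fun τ =>
        (measurable_ratioSum hX _ _ _).const_mul _).aemeasurable]
      refine ENNReal.tsum_le_tsum fun n => ?_
      rw [lintegral_tsum fun τ => ((measurable_ratioSum hX _ _ _).const_mul _).aemeasurable]
      refine ENNReal.tsum_le_tsum fun τ => ?_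
      rw [lintegral_const_mul _ (measurable_ratioSum hX _ _ _)]
      refine (mul_le_mul_right (lintegral_ratioSum_le hX (d n) n τ) _).trans_eq ?_
      rw [← ENNReal.ofReal_mul (hu n τ).le, ← ENNReal.ofReal_coe_nnreal,
        ← ENNReal.ofReal_mul (by positivity)]
      congr 1
      simp only [u, pow_add]
      field_simp
    refine ne_top_of_le_ne_top ?_ hle
    simp_rw [ENNReal.tsum_mul_left, ENNReal.tsum_mul_right]
    exact ENNReal.mul_ne_top hsq (hsum.trans ENNReal.one_lt_top).ne
  filter_upwards [ae_lt_top hGm hG] with ω hω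
  refine ⟨(G ω).toReal, ENNReal.toReal_nonneg, fun n τ => ?_⟩
  have h1 : ENNReal.ofReal (u n τ) * ratioSum P X (d n) n τ (fun i => X i ω) ≤ G ω :=
    (ENNReal.le_tsum (f := fun τ => ENNReal.ofReal (u n τ) *
      ratioSum P X (d n) n τ (fun i => X i ω)) τ).trans
      (ENNReal.le_tsum (f := fun n => ∑' τ, ENNReal.ofReal (u n τ) *
        ratioSum P X (d n) n τ (fun i => X i ω)) n)
  rw [mul_comm, ← ENNReal.le_div_iff_mul_le (Or.inl (by simpa using hu n τ))
    (Or.inl ENNReal.ofReal_ne_top), ← ENNReal.ofReal_toReal hω.ne,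
    ← ENNReal.ofReal_div_of_pos (hu n τ)] at h1
  refine h1.trans_eq (congrArg _ ?_)
  have : (0 : ℝ) < ε τ := hε τ
  simp only [u]
  field_simp

end Types

section Overfit

variable {A Ω : Type*} [Fintype A] [MeasurableSpace A] [MeasurableSingletonClass A]
  [MeasurableSpace Ω] {P : Measure Ω} [IsProbabilityMeasure P] {X : ℤ → Ω → A}

lemma cond_ne_zero_of_sample (hX : IsStationaryErgodic P X) {x : ℤ → A}
    (hpos : ∀ t : ℕ, P (pastEvent X (sample x t)) ≠ 0) (s : ℕ) :
    P[presentEvent X (x (s + 1)) | pastEvent X (sample x s)] ≠ 0 := by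
  intro h
  have h1 := cond_mul_eq_inter (μ := P) (measurableSet_pastEvent hX (sample x s))
    (presentEvent X (x (s + 1)))
  rw [h, zero_mul, ← measure_sample_and_next hX] at h1
  refine hpos (s + 1) ?_
  rw [← measure_suffix_sample hX (length_sample x (s + 1)).le]
  refine measure_mono_null (fun ω hω => ?_) h1.symm
  have h2 := hω.eq_of_length (by simp)
  rw [sample_succ, sample_succ] at h2
  obtain ⟨h3, h4⟩ := List.append_inj' h2 rfl
  simp only [Set.mem_ofPred_eq, length_sample]
  exact ⟨h3.symm, (List.singleton_inj.1 h4).symm⟩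

/-- The constant of the logarithmic bound, for weights `ε` of the trees: it depends on
the larger tree only. -/
noncomputable def overfitConst (ε : Finset (List A) → NNReal) (τ : Finset (List A)) : ℝ :=
  1 + 2 * ((Fintype.card A * τ.card + 2 : ℕ) : ℝ) + |Real.log (ε τ)|

variable [DecidableEq A] {T : ProbContextTree A}

/-- Almost surely, for large `n`, the gain of log-likelihood of any candidate tree over any
candidate tree above `τ*` is at most logarithmic: both are compared with the conditional probability
of the sample. -/
lemma ae_eventually_overfit (hX : IsCompatible P X T) {ε : Finset (List A) → NNReal}
    (hε : ∀ τ, 0 < ε τ) (hsum : ∑' τ, (ε τ : ENNReal) < 1) {d : ℕ → ℕ}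
    (hd : Tendsto d atTop atTop) :
    ∀ᵐ ω ∂P, ∀ᶠ n : ℕ in atTop, ∀ τ ∈ candidates (d n) n (fun t => X t ω),
      ∀ τ' ∈ candidates (d n) n (fun t => X t ω), TreeLE T.tree τ →
        logLik d n (fun t => X t ω) τ' - logLik d n (fun t => X t ω) τ
          ≤ overfitConst ε τ' * Real.log n := by
  filter_upwards [ae_measure_pastEvent_sample_ne_zero hX.stationaryErgodic,
    ae_exists_ratioSum_le hX.stationaryErgodic hε hsum d] with ω hpos ⟨C, hC, hR⟩
  filter_upwards [hd.eventually_ge_atTop (height T.tree), eventually_ge_atTop 3,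
    (tendsto_natCast_atTop_atTop (R := ℝ)).eventually_ge_atTop C] with n hdn hn3 hnC τ hτ τ' hτ' hle
  set x : ℤ → A := fun t => X t ω with hx
  set k := Fintype.card A * τ'.card + 2 with hk
  have hcond := cond_ne_zero_of_sample hX.stationaryErgodic hpos
  have hn : (3 : ℝ) ≤ n := by exact_mod_cast hn3
  have hετ : (0 : ℝ) < ε τ' := hε τ'
  have hK : 0 ≤ C * ((n : ℝ) + 1) ^ k / ε τ' := by positivity
  have hL : likelihood (d n) n x τ' ≤ (n * ((n : ℝ) + 1) ^ k / ε τ') * likelihood (d n) n x τ := by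
    have h1 := (likelihood_le_ratioSum_mul hcond hτ').trans (mul_le_mul_left (hR n τ') _)
    rw [← ENNReal.ofReal_toReal (ENNReal.prod_ne_top fun s _ => measure_ne_top _ _),
      ← ENNReal.ofReal_mul hK, ENNReal.ofReal_le_ofReal_iff (by positivity),
      ENNReal.toReal_prod] at h1
    refine h1.trans (mul_le_mul ?_ (prod_cond_le_likelihood hX hpos hdn hτ hle)
      (by positivity) (by positivity))
    gcongr
  have hlog := Real.log_le_log (likelihood_pos _ _ _ _) hL
  rw [Real.log_mul (by positivity) (likelihood_pos _ _ _ _).ne',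
    Real.log_div (by positivity) hετ.ne', Real.log_mul (by positivity) (by positivity),
    Real.log_pow] at hlog
  -- `n ≥ 3 > e`, so the terms that do not depend on `n` are absorbed into multiples of `log n`
  have hln : 1 ≤ Real.log n := by
    rw [Real.le_log_iff_exp_le (by positivity)]
    exact Real.exp_one_lt_three.le.trans hn
  have hl2 : Real.log ((n : ℝ) + 1) ≤ 2 * Real.log n := by
    have : Real.log (n ^ 2) = 2 * Real.log n := by simp
    rw [← this]
    exact Real.log_le_log (by positivity) (by nlinarith)
  have h3 : -Real.log (ε τ') ≤ |Real.log (ε τ')| * Real.log n :=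
    (neg_le_abs _).trans (le_mul_of_one_le_right (abs_nonneg _) hln)
  have h4 := mul_le_mul_of_nonneg_left hl2 (Nat.cast_nonneg (α := ℝ) k)
  unfold logLik overfitConst
  rw [← hk]
  linarith

end Overfit

end ContextTree

theorem theorem2 {A : Type*} [Fintype A] [DecidableEq A] [MeasurableSpace A]
    [MeasurableSingletonClass A] {Ω : Type*} [MeasurableSpace Ω] (P : Measure Ω)
    [IsProbabilityMeasure P] (X : ℤ → Ω → A) (T : ContextTree.ProbContextTree A)
    (hX : ContextTree.IsCompatible P X T) (θ : ℝ) (hθ : θ < 1) :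
    ∃ (c : Finset (List A) → ℝ) (c' : Finset (List A) → Finset (List A) → ℝ),
      (∀ τ, 0 < c τ) ∧ (∀ τ τ', 0 ≤ c' τ τ') ∧
      ∀ d : ℕ → ℕ, Tendsto d atTop atTop → (∀ᶠ n in atTop, (d n : ℝ) ≤ θ * n) →
      ∀ df : Finset (List A) → ℕ, ContextTree.IsDegreesOfFreedom df →
        ∀ᵐ ω ∂P, ∀ᶠ n : ℕ in atTop,
          (∀ τ ∈ ContextTree.champions df (d n) n (fun t => X t ω),
            ContextTree.TreeLT τ T.tree →
            ContextTree.logLik d n (fun t => X t ω) T.tree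
              - ContextTree.logLik d n (fun t => X t ω) τ ≥ c τ * n) ∧
          (∀ τ ∈ ContextTree.champions df (d n) n (fun t => X t ω),
            ∀ τ' ∈ ContextTree.champions df (d n) n (fun t => X t ω),
              ContextTree.TreeLE T.tree τ → ContextTree.TreeLT τ τ' →
              ContextTree.logLik d n (fun t => X t ω) τ'
                - ContextTree.logLik d n (fun t => X t ω) τ ≤ c' τ τ' * Real.log n) := by
  classical
  obtain ⟨ε, hε, hsum⟩ :=
    ENNReal.exists_pos_sum_of_countable one_ne_zero (Finset (List A))
  let gap : Finset (List A) → ℝ := fun τ =>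
    (1 - θ) * (ContextTree.limitLogLik P X T.tree - ContextTree.limitLogLik P X τ) / 2
  refine ⟨fun τ => if 0 < gap τ then gap τ else 1, fun _ τ' => ContextTree.overfitConst ε τ',
    fun τ => ?_, fun τ τ' => ?_, fun d hd hdθ df _ => ?_⟩
  · dsimp only
    split_ifs with h
    · exact h
    · exact one_pos
  · unfold ContextTree.overfitConst
    positivity
  filter_upwards [ContextTree.ae_eventually_underfit hX hθ hd hdθ,
    ContextTree.ae_eventually_overfit hX hε hsum hd] with ω h1 h2
  filter_upwards [h1, h2] with n hn1 hn2
  refine ⟨fun τ hτ hlt => ?_, fun τ hτ τ' hτ' hle _ => ?_⟩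
  · obtain ⟨g, hg, -⟩ := hτ
    obtain ⟨hgap, hlow⟩ := hn1 τ hg.1 hlt
    have hgap' : 0 < gap τ := half_pos (mul_pos (sub_pos.2 hθ) hgap)
    rw [if_pos hgap']
    exact hlow
  · obtain ⟨g, hg, -⟩ := hτ
    obtain ⟨g', hg', -⟩ := hτ'
    exact hn2 τ hg.1 τ' hg'.1 hle
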